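/- Let $\mathbb D=\{z\in\mathbb C:|z|<1\}$ and $dA=\frac{dx\,dy}{\pi}$. For $0<p<\infty$ let $A^p$ be the Bergman space of analytic functions $f$ on $\mathbb D$ with $\|f\|_{A^p}=\left(\int_{\mathbb D}|f|^p\,dA\right)^{1/p}<\infty$, and let $\mathcal B$ be the Bloch space of analytic functions $f$ on $\mathbb D$ with $\|f\|_{\mathcal B}=|f(0)|+\sup_{z\in\mathbb D}(1-|z|^2)|f'(z)|<\infty$. **Theorem 4.10.** Let $0<p<\infty$, $\alpha>-1$, and let $\mu$ be a positive Borel measure on $[0,1)$ such that $$\int_{[0,1)}\frac{d\mu(t)}{(1-t)^{2/p}}<\infty .$$ For $f\in A^p$ and $z\in\mathbb D$ put $$\mathcal I_{\mu_{\alpha+1}}(f)(z)=\int_{[0,1)}\frac{f(t)}{(1-tz)^{\alpha+1}}\,d\mu(t),\qquad \widetilde{\mathcal I}_{\mu_{\alpha+1}}(f)(z)=\int_{[0,1)}\frac{|f(t)|}{(1-tz)^{\alpha+1}}\,d\mu(t).$$ Then the following are equivalent: (a) $\mathcal I_{\mu_{\alpha+1}}:A^p\to\mathcal B$ is compact; (b)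 $\widetilde{\mathcal I}_{\mu_{\alpha+1}}:A^p\to\mathcal B$ is compact; (c) $\mu$ is a vanishing $\left(\frac2p+\alpha+1\right)$-Carleson measure, that is, $\displaystyle\lim_{t\to1^-}\frac{\mu([t,1))}{(1-t)^{2/p+\alpha+1}}=0$. Here a (not necessarily linear) map $T:A^p\to\mathcal B$ is compact if it maps bounded sets to relatively compact sets, i.e. for every bounded sequence $(f_n)$ in $A^p$ the sequence $(Tf_n)$ has a subsequence converging in $\mathcal B$; that $T$ maps $A^p$ into $\mathcal B$ is part of (a) and (b). -/

import Mathlib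

open MeasureTheory Filter Set Topology
open scoped ENNReal NNReal

noncomputable section

namespace BergmanBloch

/-- The open unit disk in the complex plane. -/
def unitDisk : Set ℂ := Metric.ball 0 1

/-- The normalized area measure `dA = dx dy / π` on the unit disk. -/
def areaMeasure : Measure ℂ :=
  ENNReal.ofReal Real.pi⁻¹ • (volume : Measure ℂ).restrict unitDisk

/-- The (extended) Bergman (quasi-)norm `(∫_𝔻 |f|^p dA)^(1/p)`. -/
def bergmanNorm (p : ℝ) (f : ℂ → ℂ) : ℝ≥0∞ :=
  eLpNorm f (ENNReal.ofReal p) areaMeasure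

/-- The Bergman space `A^p`: the functions which are analytic in the disk and have finite
Bergman norm. An analytic function on the disk is represented by any function on `ℂ` extending it;
no notion used here depends on the values taken outside the disk. -/
def bergmanSpace (p : ℝ) : Set (ℂ → ℂ) :=
  {f | DifferentiableOn ℂ f unitDisk ∧ bergmanNorm p f < ∞}

/-- The (extended) Bloch norm `|f(0)| + sup_{z ∈ 𝔻} (1 - |z|^2) |f'(z)|`. -/
def blochNorm (f : ℂ → ℂ) : ℝ≥0∞ :=
  ‖f 0‖ₑ + ⨆ z ∈ unitDisk, ENNReal.ofReal (1 - ‖z‖ ^ 2) * ‖deriv f z‖ₑ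

/-- The Bloch space: the functions which are analytic in the disk and have finite Bloch norm. -/
def blochSpace : Set (ℂ → ℂ) :=
  {f | DifferentiableOn ℂ f unitDisk ∧ blochNorm f < ∞}

/-- The integral type Hilbert operator `f ↦ ∫_{[0,1)} f(t) / (1 - t z)^(α+1) dμ(t)`
(principal branch of the power; `1 - t z` has positive real part for `z` in the disk). -/
def hilbertOp (α : ℝ) (μ : Measure (Ico (0 : ℝ) 1)) (f : ℂ → ℂ) (z : ℂ) : ℂ :=
  ∫ t : Ico (0 : ℝ) 1, f ((t : ℝ) : ℂ) / (1 - ((t : ℝ) : ℂ) * z) ^ ((α + 1 : ℝ) : ℂ) ∂μ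

/-- The sublinear integral type Hilbert operator
`f ↦ ∫_{[0,1)} |f(t)| / (1 - t z)^(α+1) dμ(t)`. -/
def sublinearHilbertOp (α : ℝ) (μ : Measure (Ico (0 : ℝ) 1)) (f : ℂ → ℂ) (z : ℂ) : ℂ :=
  ∫ t : Ico (0 : ℝ) 1,
    ((‖f ((t : ℝ) : ℂ)‖ : ℝ) : ℂ) / (1 - ((t : ℝ) : ℂ) * z) ^ ((α + 1 : ℝ) : ℂ) ∂μ

/-- `T : A^p → 𝓑` is compact: `T` maps `A^p` into the Bloch space, and it maps bounded sets to
relatively compact sets, i.e. for every bounded sequence `f n` in `A^p`, the sequence `T (f n)` has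
a subsequence which converges in the Bloch norm to an element of the Bloch space.
`T` is not required to be linear. -/
def IsCompactBergmanToBloch (p : ℝ) (T : (ℂ → ℂ) → (ℂ → ℂ)) : Prop :=
  (∀ f ∈ bergmanSpace p, T f ∈ blochSpace) ∧
  ∀ f : ℕ → ℂ → ℂ, (∀ n, f n ∈ bergmanSpace p) →
    (∃ M : ℝ≥0, ∀ n, bergmanNorm p (f n) ≤ M) →
    ∃ φ : ℕ → ℕ, StrictMono φ ∧ ∃ g ∈ blochSpace,
      Tendsto (fun n => blochNorm (T (f (φ n)) - g)) atTop (𝓝 0)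

/-- `μ` is a vanishing `s`-Carleson measure on `[0,1)`: `μ([t,1)) / (1-t)^s → 0` as `t → 1⁻`. -/
def IsVanishingCarleson (s : ℝ) (μ : Measure (Ico (0 : ℝ) 1)) : Prop :=
  Tendsto (fun t : ℝ => μ {x | t ≤ (x : ℝ)} / ENNReal.ofReal ((1 - t) ^ s)) (𝓝[<] 1) (𝓝 0)

end BergmanBloch

end

/-!
Both operators have the form `f ↦ kernelOp α μ (q ∘ f)`, with `q` the identity or the modulus, so
both equivalences with the Carleson condition are instances of one argument.
Write `a = 2 / p` and `s = a + α + 1`.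

*Sufficiency.* Jensen's formula makes `‖f‖ ^ p` subharmonic for every `p > 0`, whence
`‖f t‖ ≤ ‖f‖_{A^p} (1 - t)^(-a)` (`norm_le_of_bergmanNorm_le`). The derivative of the image is an
integral against a kernel of size `|1 - t z|^(-(α + 2))`, and a dyadic decomposition shows that
`(1 - r) ∫ (1 - t)^(-a) (1 - t r)^(-(α + 2)) dμ(t)` is bounded, uniformly in `r`, by a multiple of
the `s`-Carleson constant of `μ` (`lintegral_blochKernel_le`). For a vanishing Carleson measure the
constant of the restriction to `[ρ, 1)` is arbitrarily small, while on `[0, ρ)` the kernel is bounded;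
hence dominated pointwise convergence on `[0, 1)` yields convergence in the Bloch norm
(`tendsto_blochNorm_kernelOp_sub`). A bounded sequence in `A^p` has a pointwise convergent
subsequence by a normal family argument on Taylor coefficients
(`exists_subseq_tendsto_of_locally_bounded`), and pointwise convergence is preserved by the
continuous map `q`, so linearity plays no role.

*Necessity.* The functions `f_b(z) = (1 - b²)^a / (1 - b z)^(2a)` are in the unit ball of `A^p`,
because `|f_b|^p` is the Jacobian of a disk automorphism. They are positive on `[0, 1)`, so `q` does
not change them there, and they tend to `0` pointwise as `b → 1`. Thus every Bloch limit of their
images has zero derivative, and by compactness the weighted derivatives at `z = b` tend to `0` along a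
subsequence. Those derivatives dominate `μ([b, 1)) / (1 - b)^s` (`mul_carlesonQuotient_le`).
-/

namespace BergmanBloch

/-! ### Pointwise growth of Bergman functions -/

/-- Subharmonicity of `log ‖f‖`: in Jensen's formula every zero contributes a nonnegative term. -/
theorem log_norm_le_circleAverage {f : ℂ → ℂ} {c : ℂ} {R : ℝ} (hR : 0 < R)
    (hf : AnalyticOnNhd ℂ f (Metric.closedBall c R)) (hc : f c ≠ 0) :
    Real.log ‖f c‖ ≤ Real.circleAverage (fun z => Real.log ‖f z‖) c R := by
  have hf' : AnalyticOnNhd ℂ f (Metric.closedBall c |R|) := by rwa [abs_of_pos hR]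
  rw [hf'.circleAverage_log_norm hR.ne' hc]
  refine le_add_of_nonneg_left (finsum_nonneg fun u => ?_)
  by_cases hu : u ∈ Metric.closedBall c |R|
  · refine mul_nonneg
      (mod_cast MeromorphicOn.AnalyticOnNhd.divisor_nonneg hf' u) ?_
    rcases eq_or_ne c u with rfl | hne
    · simp
    · refine Real.log_nonneg ?_
      have h0 : 0 < ‖c - u‖ := norm_pos_iff.2 (sub_ne_zero.2 hne)
      rw [← div_eq_mul_inv, le_div_iff₀ h0, one_mul]
      rw [abs_of_pos hR, Metric.mem_closedBall, dist_comm, dist_eq_norm] at hu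
      exact hu
  · simp [Function.locallyFinsuppWithin.apply_eq_zero_of_notMem _ hu]

theorem circleIntegrable_norm_rpow {f : ℂ → ℂ} {c : ℂ} {R p : ℝ} (hp : 0 < p) (hR : 0 < R)
    (hf : ContinuousOn f (Metric.closedBall c R)) :
    CircleIntegrable (fun z => ‖f z‖ ^ p) c R :=
  ContinuousOn.circleIntegrable hR.le
    ((hf.mono Metric.sphere_subset_closedBall).norm.rpow_const fun _ _ => Or.inr hp.le)

/-- Subharmonicity of `‖f‖ ^ p` for every `p > 0`. It follows from that of `log ‖f‖` by averaging
the inequality `log x ≤ x - 1` at `x = (‖f z‖ / ‖f c‖) ^ p`. -/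
theorem norm_rpow_le_circleAverage {f : ℂ → ℂ} {c : ℂ} {R p : ℝ} (hp : 0 < p) (hR : 0 < R)
    (hf : AnalyticOnNhd ℂ f (Metric.closedBall c R)) :
    ‖f c‖ ^ p ≤ Real.circleAverage (fun z => ‖f z‖ ^ p) c R := by
  by_cases hc : f c = 0
  · rw [hc, norm_zero, Real.zero_rpow hp.ne']
    exact Real.circleAverage_nonneg_of_nonneg fun z _ => by positivity
  have ha : 0 < ‖f c‖ := norm_pos_iff.2 hc
  have hap : 0 < ‖f c‖ ^ p := by positivity
  have hint := circleIntegrable_norm_rpow hp hR hf.continuousOn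
  have hlogint : CircleIntegrable (fun z => Real.log ‖f z‖) c R :=
    MeromorphicOn.circleIntegrable_log_norm
      ((hf.mono (by rw [abs_of_pos hR]; exact Metric.sphere_subset_closedBall)).meromorphicOn)
  -- Since `Real.log 0 = 0`, the pointwise inequality can fail at the zeros of `f`. They do not
  -- affect the average, so `G` takes there a value for which the inequality is trivial.
  set G : ℂ → ℝ := fun z => if f z = 0 then Real.log ‖f c‖ - 1 / p else Real.log ‖f z‖ with hG
  have hnz : {z | f z ≠ 0} ∈ codiscreteWithin (Metric.sphere c |R|) := by
    refine codiscreteWithin_mono ?_ (hf.preimage_zero_mem_codiscreteWithin hc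
      (Metric.mem_closedBall_self hR.le)
      ((convex_closedBall c R).isConnected ⟨c, Metric.mem_closedBall_self hR.le⟩))
    rw [abs_of_pos hR]; exact Metric.sphere_subset_closedBall
  have hGeq : (fun z => Real.log ‖f z‖) =ᶠ[codiscreteWithin (Metric.sphere c |R|)] G := by
    filter_upwards [hnz] with z hz
    rw [hG]; exact (if_neg hz).symm
  have hGint : CircleIntegrable G c R := hlogint.congr_codiscreteWithin hGeq
  have hle : ∀ z, G z ≤ (1 / p / ‖f c‖ ^ p) * ‖f z‖ ^ p + (Real.log ‖f c‖ - 1 / p) := by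
    intro z
    by_cases hz : f z = 0
    · simp only [hG, hz, if_true]
      have : 0 ≤ (1 / p / ‖f c‖ ^ p) * ‖(0 : ℂ)‖ ^ p := by positivity
      linarith
    · have hz' : 0 < ‖f z‖ := norm_pos_iff.2 hz
      simp only [hG, hz, if_false]
      have h1 := Real.log_le_sub_one_of_pos (x := ‖f z‖ ^ p / ‖f c‖ ^ p) (by positivity)
      rw [Real.log_div (by positivity) (by positivity), Real.log_rpow hz', Real.log_rpow ha] at h1
      have h2 : (1 / p / ‖f c‖ ^ p) * ‖f z‖ ^ p = (‖f z‖ ^ p / ‖f c‖ ^ p) / p := by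
        field_simp
      rw [h2]
      have h3 : Real.log ‖f z‖ - Real.log ‖f c‖ ≤ (‖f z‖ ^ p / ‖f c‖ ^ p - 1) / p := by
        rw [le_div_iff₀ hp]; linarith
      rw [sub_div] at h3
      linarith
  have hint2 : CircleIntegrable (fun z => (1 / p / ‖f c‖ ^ p) * ‖f z‖ ^ p) c R :=
    IntervalIntegrable.const_mul hint _
  have key := Real.circleAverage_mono hGint
    (CircleIntegrable.add hint2 (circleIntegrable_const (Real.log ‖f c‖ - 1 / p) c R))
    (fun z _ => hle z)
  have hlog := log_norm_le_circleAverage hR hf hc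
  rw [Real.circleAverage_congr_codiscreteWithin hGeq hR.ne'] at hlog
  have hsum : Real.circleAverage ((fun z => (1 / p / ‖f c‖ ^ p) * ‖f z‖ ^ p) +
      fun _ => (Real.log ‖f c‖ - 1 / p)) c R =
      (1 / p / ‖f c‖ ^ p) * Real.circleAverage (fun z => ‖f z‖ ^ p) c R
        + (Real.log ‖f c‖ - 1 / p) := by
    rw [Real.circleAverage_add hint2 (circleIntegrable_const _ c R), Real.circleAverage_const]
    congr 1
    exact Real.circleAverage_smul (a := (1 / p / ‖f c‖ ^ p)) (f := fun z => ‖f z‖ ^ p)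
  have h5 := hlog.trans (key.trans_eq hsum)
  have h6 : 1 / p ≤ (1 / p / ‖f c‖ ^ p) * Real.circleAverage (fun z => ‖f z‖ ^ p) c R := by
    linarith
  have h7 : (1 / p / ‖f c‖ ^ p) * Real.circleAverage (fun z => ‖f z‖ ^ p) c R
      = (Real.circleAverage (fun z => ‖f z‖ ^ p) c R / ‖f c‖ ^ p) * (1 / p) := by
    field_simp
  rw [h7] at h6
  have h8 : 1 ≤ Real.circleAverage (fun z => ‖f z‖ ^ p) c R / ‖f c‖ ^ p := by
    by_contra! h
    have : (Real.circleAverage (fun z => ‖f z‖ ^ p) c R / ‖f c‖ ^ p) * (1 / p) < 1 * (1 / p) :=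
      mul_lt_mul_of_pos_right h (by positivity)
    linarith
  rwa [one_le_div hap] at h8

/-- The area version of subharmonicity, on a disc `B(c, d)` inside the domain of analyticity. -/
theorem ofReal_sq_mul_enorm_rpow_le {f : ℂ → ℂ} {c : ℂ} {d p : ℝ} (hp : 0 < p) (hd : 0 < d)
    (hf : DifferentiableOn ℂ f (Metric.ball c d)) :
    ENNReal.ofReal (Real.pi * d ^ 2) * ‖f c‖ₑ ^ p ≤ ∫⁻ z in Metric.ball c d, ‖f z‖ₑ ^ p := by
  have hcirc : ∀ r ∈ Ioo 0 d, ENNReal.ofReal (2 * Real.pi) * ‖f c‖ₑ ^ p ≤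
      ∫⁻ θ in Ioo (-Real.pi) Real.pi, ‖f (circleMap c r θ)‖ₑ ^ p := by
    intro r hr
    have hsub : Metric.closedBall c r ⊆ Metric.ball c d := Metric.closedBall_subset_ball hr.2
    have han : AnalyticOnNhd ℂ f (Metric.closedBall c r) :=
      (hf.analyticOnNhd Metric.isOpen_ball).mono hsub
    have h := norm_rpow_le_circleAverage hp hr.1 han
    have hcont : Continuous fun θ => ‖f (circleMap c r θ)‖ ^ p := by
      refine Continuous.rpow_const (Continuous.norm ?_) fun _ => Or.inr hp.le
      exact han.continuousOn.comp_continuous (continuous_circleMap c r)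
        fun θ => circleMap_mem_closedBall c hr.1.le θ
    have hper : Function.Periodic (fun θ => ‖f (circleMap c r θ)‖ ^ p) (2 * Real.pi) := by
      intro θ; simp only [periodic_circleMap c r θ]
    rw [Real.circleAverage_def] at h
    have hshift := hper.intervalIntegral_add_eq 0 (-Real.pi)
    rw [zero_add, show -Real.pi + 2 * Real.pi = Real.pi by ring] at hshift
    rw [hshift, smul_eq_mul, intervalIntegral.integral_of_le (by linarith [Real.pi_pos]),
      integral_Ioc_eq_integral_Ioo, inv_mul_eq_div, le_div_iff₀ (by positivity)] at h
    have h2 := ENNReal.ofReal_le_ofReal h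
    rw [ofReal_integral_eq_lintegral_ofReal
      ((hcont.integrableOn_Icc).mono_set Ioo_subset_Icc_self)
      (ae_of_all _ fun θ => by positivity), mul_comm, ENNReal.ofReal_mul (by positivity)] at h2
    simpa only [← ENNReal.ofReal_rpow_of_nonneg (norm_nonneg _) hp.le, ofReal_norm]
      using h2
  have htrans : ∫⁻ z in Metric.ball c d, ‖f z‖ₑ ^ p =
      ∫⁻ w, (Metric.ball c d).indicator (fun z => ‖f z‖ₑ ^ p) (c + w) := by
    rw [← lintegral_indicator Metric.isOpen_ball.measurableSet,
      ← lintegral_add_left_eq_self (μ := volume) _ c]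
  rw [htrans, ← Complex.lintegral_comp_polarCoord_symm]
  have hcm : ∀ q : ℝ × ℝ, c + Complex.polarCoord.symm q = circleMap c q.1 q.2 := by
    intro q
    rw [Complex.polarCoord_symm_apply, circleMap, Complex.exp_mul_I, Complex.ofReal_cos,
      Complex.ofReal_sin]
  simp only [hcm]
  have hmeas : AEMeasurable (fun q : ℝ × ℝ => ENNReal.ofReal q.1 •
      (Metric.ball c d).indicator (fun z => ‖f z‖ₑ ^ p) (circleMap c q.1 q.2))
      ((volume.restrict (Ioi 0)).prod (volume.restrict (Ioo (-Real.pi) Real.pi))) := by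
    have h1 : Measurable ((Metric.ball c d).indicator fun z => ‖f z‖ₑ ^ p) := by
      classical
      rw [← piecewise_eq_indicator]
      exact ContinuousOn.measurable_piecewise
        (ENNReal.continuous_rpow_const.comp_continuousOn hf.continuousOn.enorm)
        continuousOn_const Metric.isOpen_ball.measurableSet
    have h2 : Continuous fun q : ℝ × ℝ => circleMap c q.1 q.2 := by
      unfold circleMap; fun_prop
    exact ((ENNReal.measurable_ofReal.comp measurable_fst).mul
      (h1.comp h2.measurable)).aemeasurable
  have htarget : polarCoord.target = Ioi (0 : ℝ) ×ˢ Ioo (-Real.pi) Real.pi := rfl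
  rw [htarget, Measure.volume_eq_prod, ← Measure.prod_restrict, lintegral_prod _ hmeas]
  calc ENNReal.ofReal (Real.pi * d ^ 2) * ‖f c‖ₑ ^ p
      = ∫⁻ r in Ioo 0 d, ENNReal.ofReal r * (ENNReal.ofReal (2 * Real.pi) * ‖f c‖ₑ ^ p) := by
        have hI : ∫⁻ r in Ioo 0 d, ENNReal.ofReal r = ENNReal.ofReal (d ^ 2 / 2) := by
          rw [← ofReal_integral_eq_lintegral_ofReal, ← integral_Ioc_eq_integral_Ioo,
            ← intervalIntegral.integral_of_le hd.le, integral_id]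
          · simp
          · exact (continuous_id.integrableOn_Icc).mono_set Ioo_subset_Icc_self
          · exact (ae_restrict_mem measurableSet_Ioo).mono fun r hr => hr.1.le
        rw [lintegral_mul_const _ ENNReal.measurable_ofReal, hI, ← mul_assoc,
          ← ENNReal.ofReal_mul (by positivity)]
        congr 2
        ring
    _ ≤ ∫⁻ r in Ioo 0 d, ∫⁻ θ in Ioo (-Real.pi) Real.pi, ENNReal.ofReal r •
          (Metric.ball c d).indicator (fun z => ‖f z‖ₑ ^ p) (circleMap c r θ) := by
        refine setLIntegral_mono' measurableSet_Ioo fun r hr => ?_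
        simp only [smul_eq_mul]
        rw [lintegral_const_mul' _ _ ENNReal.ofReal_ne_top]
        refine mul_le_mul_right ((hcirc r hr).trans_eq ?_) _
        refine lintegral_congr fun θ => (indicator_of_mem ?_ (fun z => ‖f z‖ₑ ^ p)).symm
        rw [Metric.mem_ball, dist_eq_norm, circleMap_sub_center, norm_circleMap_zero,
          abs_of_pos hr.1]
        exact hr.2
    _ ≤ _ := lintegral_mono_set Ioo_subset_Ioi_self

/-- The growth estimate `‖f z‖ ≤ ‖f‖_{A^p} (1 - |z|)^(-2/p)`. -/
theorem norm_le_of_bergmanNorm_le {p : ℝ} (hp : 0 < p) {f : ℂ → ℂ} {M : ℝ≥0}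
    (hf : DifferentiableOn ℂ f unitDisk) (hM : bergmanNorm p f ≤ M) {z : ℂ} (hz : ‖z‖ < 1) :
    ‖f z‖ ≤ M * (1 - ‖z‖) ^ (-(2 / p)) := by
  have hd : 0 < 1 - ‖z‖ := by linarith
  have hsub : Metric.ball z (1 - ‖z‖) ⊆ unitDisk :=
    Metric.ball_subset_ball' (by simp)
  have h1 := ofReal_sq_mul_enorm_rpow_le hp hd (hf.mono hsub)
  have hpow : ∫⁻ z, ‖f z‖ₑ ^ p ∂areaMeasure ≤ (M : ℝ≥0∞) ^ p := by
    have h0 : ENNReal.ofReal p ≠ 0 := by simpa using hp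
    rw [bergmanNorm, eLpNorm_eq_lintegral_rpow_enorm_toReal h0 ENNReal.ofReal_ne_top,
      ENNReal.toReal_ofReal hp.le] at hM
    have := ENNReal.rpow_le_rpow hM hp.le
    rwa [← ENNReal.rpow_mul, one_div_mul_cancel hp.ne', ENNReal.rpow_one] at this
  rw [areaMeasure, lintegral_smul_measure, smul_eq_mul] at hpow
  have h2 : ENNReal.ofReal ((1 - ‖z‖) ^ 2) * ‖f z‖ₑ ^ p ≤ (M : ℝ≥0∞) ^ p := by
    refine le_trans ?_ hpow
    calc ENNReal.ofReal ((1 - ‖z‖) ^ 2) * ‖f z‖ₑ ^ p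
        = ENNReal.ofReal Real.pi⁻¹ * (ENNReal.ofReal (Real.pi * (1 - ‖z‖) ^ 2) * ‖f z‖ₑ ^ p) := by
          rw [← mul_assoc, ← ENNReal.ofReal_mul (by positivity), ← mul_assoc,
            inv_mul_cancel₀ Real.pi_ne_zero, one_mul]
      _ ≤ _ := mul_le_mul_right (h1.trans (lintegral_mono_set hsub)) _
  have h3 : (1 - ‖z‖) ^ 2 * ‖f z‖ ^ p ≤ (M : ℝ) ^ p := by
    rw [← ofReal_norm, ENNReal.ofReal_rpow_of_nonneg (norm_nonneg _) hp.le,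
      ← ENNReal.ofReal_mul (by positivity), ← ENNReal.ofReal_coe_nnreal,
      ENNReal.ofReal_rpow_of_nonneg M.coe_nonneg hp.le] at h2
    exact (ENNReal.ofReal_le_ofReal_iff (by positivity)).1 h2
  rw [← Real.rpow_le_rpow_iff (norm_nonneg _) (by positivity) hp,
    Real.mul_rpow M.coe_nonneg (by positivity), ← Real.rpow_mul hd.le,
    show -(2 / p) * p = -2 by field_simp, Real.rpow_neg hd.le, Real.rpow_two,
    ← div_eq_mul_inv, le_div_iff₀ (by positivity), mul_comm]
  exact h3

/-! ### Integrals against Carleson measures -/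

section Dyadic

variable {X : Type*} [MeasurableSpace X] {ν : Measure X} {u : X → ℝ} {s : ℝ} {K : ℝ≥0∞}

/-- A countable cover of the integrand by multiples of indicators of sublevel sets of `u` bounds
its integral against a measure with `ν {u ≤ h} ≤ K h ^ s`. -/
theorem lintegral_le_tsum_of_carleson (hu : Measurable u)
    (hν : ∀ h : ℝ, 0 < h → ν {x | u x ≤ h} ≤ K * ENNReal.ofReal (h ^ s))
    {g : X → ℝ≥0∞} {c y : ℕ → ℝ} (hc : ∀ k, 0 ≤ c k) (hy : ∀ k, 0 < y k)
    (hg : ∀ x, g x ≠ 0 → ∃ k, u x ≤ y k ∧ g x ≤ ENNReal.ofReal (c k)) :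
    ∫⁻ x, g x ∂ν ≤ K * ∑' k, ENNReal.ofReal (c k * y k ^ s) := by
  have hm : ∀ k, MeasurableSet {x | u x ≤ y k} := fun k => hu measurableSet_Iic
  calc ∫⁻ x, g x ∂ν
      ≤ ∫⁻ x, ∑' k, {x | u x ≤ y k}.indicator (fun _ => ENNReal.ofReal (c k)) x ∂ν := by
        refine lintegral_mono fun x => ?_
        by_cases h0 : g x = 0
        · rw [h0]; exact zero_le
        obtain ⟨k, hk, hk'⟩ := hg x h0
        refine hk'.trans (le_trans ?_ (ENNReal.le_tsum k))
        rw [indicator_of_mem (show x ∈ {x | u x ≤ y k} from hk)]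
    _ = ∑' k, ENNReal.ofReal (c k) * ν {x | u x ≤ y k} := by
        rw [lintegral_tsum fun k => (measurable_const.indicator (hm k)).aemeasurable]
        exact tsum_congr fun k => lintegral_indicator_const (hm k) _
    _ ≤ ∑' k, K * ENNReal.ofReal (c k * y k ^ s) := by
        refine ENNReal.tsum_le_tsum fun k => ?_
        rw [ENNReal.ofReal_mul (hc k), mul_left_comm]
        exact mul_le_mul_right (hν _ (hy k)) _
    _ = _ := ENNReal.tsum_mul_left

theorem tsum_ofReal_mul_geometric {A q : ℝ} (hA : 0 ≤ A) (hq : 0 ≤ q) (hq1 : q < 1) :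
    ∑' k : ℕ, ENNReal.ofReal (A * q ^ k) = ENNReal.ofReal (A / (1 - q)) := by
  rw [← ENNReal.ofReal_tsum_of_nonneg (fun k => by positivity)
    ((summable_geometric_of_lt_one hq hq1).mul_left A), tsum_mul_left,
    tsum_geometric_of_lt_one hq hq1, div_eq_mul_inv]

/-- Integral of a negative power of `u`, with exponent below `s`, near the zero set of `u`. -/
theorem setLIntegral_rpow_neg_le_of_carleson (hu : Measurable u) (hpos : ∀ x, 0 < u x)
    (hν : ∀ h : ℝ, 0 < h → ν {x | u x ≤ h} ≤ K * ENNReal.ofReal (h ^ s))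
    {a x₀ : ℝ} (ha : 0 ≤ a) (has : a < s) (hx₀ : 0 < x₀) :
    ∫⁻ x in {x | u x ≤ x₀}, ENNReal.ofReal (u x ^ (-a)) ∂ν ≤
      K * ENNReal.ofReal (x₀ ^ (s - a) * (2 ^ a / (1 - 2 ^ (a - s)))) := by
  have hm : MeasurableSet {x | u x ≤ x₀} := hu measurableSet_Iic
  rw [← lintegral_indicator hm]
  have hy : ∀ k : ℕ, 0 < x₀ * (1 / 2 : ℝ) ^ k := fun k => by positivity
  refine (lintegral_le_tsum_of_carleson hu hν (c := fun k => (x₀ * (1 / 2 : ℝ) ^ (k + 1)) ^ (-a))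
    (fun k => by positivity) hy ?_).trans_eq ?_
  · intro x hx
    have hxm : u x ≤ x₀ := by
      by_contra h
      exact hx (indicator_of_notMem (s := {x | u x ≤ x₀}) h _)
    rw [indicator_of_mem (show x ∈ {x | u x ≤ x₀} from hxm)]
    obtain ⟨k, hk1, hk2⟩ := exists_nat_pow_near_of_lt_one (x := u x / x₀) (y := (1 / 2 : ℝ))
      (div_pos (hpos x) hx₀) ((div_le_one hx₀).2 hxm) (by norm_num) (by norm_num)
    rw [lt_div_iff₀ hx₀, mul_comm] at hk1
    rw [div_le_iff₀ hx₀, mul_comm] at hk2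
    exact ⟨k, hk2, ENNReal.ofReal_le_ofReal
      (Real.rpow_le_rpow_of_nonpos (hy (k + 1)) hk1.le (by linarith))⟩
  · congr 1
    have h2 : (2 : ℝ) ^ (a - s) < 1 := Real.rpow_lt_one_of_one_lt_of_neg (by norm_num) (by linarith)
    rw [mul_div_assoc', ← tsum_ofReal_mul_geometric (by positivity) (by positivity) h2]
    refine tsum_congr fun k => congrArg _ ?_
    have e : ∀ j : ℕ, (1 / 2 : ℝ) ^ j = 2 ^ (-(j : ℝ)) := fun j => by
      rw [Real.rpow_neg (by norm_num), Real.rpow_natCast]; simp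
    rw [e, e, Real.mul_rpow hx₀.le (by positivity), Real.mul_rpow hx₀.le (by positivity),
      ← Real.rpow_mul (by norm_num), ← Real.rpow_mul (by norm_num), ← Real.rpow_natCast (_ ^ _),
      ← Real.rpow_mul (by norm_num)]
    calc x₀ ^ (-a) * 2 ^ (-((k + 1 : ℕ) : ℝ) * -a) * (x₀ ^ s * 2 ^ (-(k : ℝ) * s))
        = (x₀ ^ (-a) * x₀ ^ s) * (2 ^ (-((k + 1 : ℕ) : ℝ) * -a) * 2 ^ (-(k : ℝ) * s)) := by ring
      _ = x₀ ^ (s - a) * (2 ^ a * 2 ^ ((a - s) * k)) := by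
        rw [← Real.rpow_add hx₀, ← Real.rpow_add (by norm_num), ← Real.rpow_add (by norm_num)]
        push_cast
        ring_nf
      _ = _ := by ring

/-- Integral of a negative power of `u`, with exponent above `s`, away from the zero set
of `u`. -/
theorem setLIntegral_compl_rpow_neg_le_of_carleson (hu : Measurable u)
    (hν : ∀ h : ℝ, 0 < h → ν {x | u x ≤ h} ≤ K * ENNReal.ofReal (h ^ s))
    {b x₀ : ℝ} (hb : 0 ≤ b) (hsb : s < b) (hx₀ : 0 < x₀) :
    ∫⁻ x in {x | u x ≤ x₀}ᶜ, ENNReal.ofReal (u x ^ (-b)) ∂ν ≤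
      K * ENNReal.ofReal (x₀ ^ (s - b) * (2 ^ s / (1 - 2 ^ (s - b)))) := by
  have hm : MeasurableSet {x | u x ≤ x₀} := hu measurableSet_Iic
  rw [← lintegral_indicator hm.compl]
  have hy : ∀ k : ℕ, 0 < x₀ * (2 : ℝ) ^ k := fun k => by positivity
  refine (lintegral_le_tsum_of_carleson hu hν (c := fun k => (x₀ * (2 : ℝ) ^ k) ^ (-b))
    (fun k => by positivity) (fun k => hy (k + 1)) ?_).trans_eq ?_
  · intro x hx
    have hxm : x₀ < u x := by
      by_contra h
      exact hx (indicator_of_notMem (s := {x | u x ≤ x₀}ᶜ) (fun h' => h' (not_lt.1 h)) _)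
    rw [indicator_of_mem (show x ∈ {x | u x ≤ x₀}ᶜ from not_le.2 hxm)]
    obtain ⟨k, hk1, hk2⟩ := exists_nat_pow_near (x := u x / x₀) (y := (2 : ℝ))
      ((one_le_div hx₀).2 hxm.le) (by norm_num)
    rw [le_div_iff₀ hx₀, mul_comm] at hk1
    rw [div_lt_iff₀ hx₀, mul_comm] at hk2
    exact ⟨k, hk2.le, ENNReal.ofReal_le_ofReal
      (Real.rpow_le_rpow_of_nonpos (hy k) hk1 (by linarith))⟩
  · congr 1
    have h2 : (2 : ℝ) ^ (s - b) < 1 := Real.rpow_lt_one_of_one_lt_of_neg (by norm_num) (by linarith)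
    rw [mul_div_assoc', ← tsum_ofReal_mul_geometric (by positivity) (by positivity) h2]
    refine tsum_congr fun k => congrArg _ ?_
    rw [Real.mul_rpow hx₀.le (by positivity), Real.mul_rpow hx₀.le (by positivity),
      ← Real.rpow_natCast, ← Real.rpow_natCast, ← Real.rpow_natCast (_ ^ _),
      ← Real.rpow_mul (by norm_num), ← Real.rpow_mul (by norm_num), ← Real.rpow_mul (by norm_num)]
    calc x₀ ^ (-b) * 2 ^ ((k : ℝ) * -b) * (x₀ ^ s * 2 ^ (((k + 1 : ℕ) : ℝ) * s))
        = (x₀ ^ (-b) * x₀ ^ s) * (2 ^ ((k : ℝ) * -b) * 2 ^ (((k + 1 : ℕ) : ℝ) * s)) := by ring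
      _ = x₀ ^ (s - b) * (2 ^ s * 2 ^ ((s - b) * k)) := by
        rw [← Real.rpow_add hx₀, ← Real.rpow_add (by norm_num), ← Real.rpow_add (by norm_num)]
        push_cast
        ring_nf
      _ = _ := by ring

end Dyadic

/-- The constant in the Bloch kernel estimate for an `(a + α + 1)`-Carleson measure. -/
noncomputable def kernelConst (a α : ℝ) : ℝ :=
  2 ^ a / (1 - 2 ^ (a - (a + α + 1))) +
    2 ^ (a + α + 1) / (1 - 2 ^ (a + α + 1 - (a + α + 2)))

/-- If `μ` is an `(a + α + 1)`-Carleson measure with constant `K`, then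
`(1 - r) ∫ (1 - t)^(-a) (1 - t r)^(-(α + 2)) dμ(t)` is bounded by a multiple of `K`, uniformly in
`r < 1`. The two regimes are `1 - t ≤ 1 - r` and `1 - t > 1 - r`. -/
theorem lintegral_blochKernel_le {μ : Measure (Ico (0 : ℝ) 1)} {a α : ℝ} {K : ℝ≥0∞}
    (ha : 0 ≤ a) (hα : -1 < α)
    (hμ : ∀ h : ℝ, 0 < h →
      μ {x | 1 - (x : ℝ) ≤ h} ≤ K * ENNReal.ofReal (h ^ (a + α + 1)))
    {r : ℝ} (hr0 : 0 ≤ r) (hr1 : r < 1) :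
    ∫⁻ t, ENNReal.ofReal ((1 - (t : ℝ)) ^ (-a) * ((1 - r) * (1 - t * r) ^ (-(α + 2)))) ∂μ ≤
      K * ENNReal.ofReal (kernelConst a α) := by
  have hu : Measurable fun t : Ico (0 : ℝ) 1 => 1 - (t : ℝ) := by fun_prop
  have hpos : ∀ t : Ico (0 : ℝ) 1, 0 < 1 - (t : ℝ) := fun t => by linarith [t.2.2]
  have hx : 0 < 1 - r := by linarith
  have hA : (2 : ℝ) ^ (a - (a + α + 1)) < 1 :=
    Real.rpow_lt_one_of_one_lt_of_neg (by norm_num) (by linarith)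
  have hB : (2 : ℝ) ^ (a + α + 1 - (a + α + 2)) < 1 :=
    Real.rpow_lt_one_of_one_lt_of_neg (by norm_num) (by linarith)
  have hle1 : ∀ t : Ico (0 : ℝ) 1, 1 - (t : ℝ) ≤ 1 - t * r := fun t => by
    nlinarith [t.2.1, t.2.2]
  have hle2 : ∀ t : Ico (0 : ℝ) 1, 1 - r ≤ 1 - t * r := fun t => by
    nlinarith [t.2.1, t.2.2]
  rw [← lintegral_add_compl _ (A := {t : Ico (0 : ℝ) 1 | 1 - (t : ℝ) ≤ 1 - r})
    (hu measurableSet_Iic), kernelConst,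
    ENNReal.ofReal_add (div_nonneg (by positivity) (by linarith))
      (div_nonneg (by positivity) (by linarith)), mul_add]
  refine add_le_add ?_ ?_
  · calc ∫⁻ t in {t : Ico (0 : ℝ) 1 | 1 - (t : ℝ) ≤ 1 - r},
          ENNReal.ofReal ((1 - (t : ℝ)) ^ (-a) * ((1 - r) * (1 - t * r) ^ (-(α + 2)))) ∂μ
        ≤ ∫⁻ t in {t : Ico (0 : ℝ) 1 | 1 - (t : ℝ) ≤ 1 - r},
          ENNReal.ofReal ((1 - r) ^ (-(α + 1))) * ENNReal.ofReal ((1 - (t : ℝ)) ^ (-a)) ∂μ := by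
          refine lintegral_mono fun t => ?_
          simp only
          rw [← ENNReal.ofReal_mul (by positivity), mul_comm ((1 - r) ^ (-(α + 1)))]
          refine ENNReal.ofReal_le_ofReal (mul_le_mul_of_nonneg_left ?_
            (Real.rpow_nonneg (hpos t).le _))
          calc (1 - r) * (1 - t * r) ^ (-(α + 2)) ≤ (1 - r) * (1 - r) ^ (-(α + 2)) :=
                mul_le_mul_of_nonneg_left
                  (Real.rpow_le_rpow_of_nonpos hx (hle2 t) (by linarith)) hx.le
            _ = (1 - r) ^ (-(α + 1)) := by
                rw [← Real.rpow_one_add' hx.le (by linarith)]; ring_nf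
      _ ≤ ENNReal.ofReal ((1 - r) ^ (-(α + 1))) *
          (K * ENNReal.ofReal ((1 - r) ^ (a + α + 1 - a) *
            (2 ^ a / (1 - 2 ^ (a - (a + α + 1)))))) := by
          rw [lintegral_const_mul' _ _ ENNReal.ofReal_ne_top]
          exact mul_le_mul_right (setLIntegral_rpow_neg_le_of_carleson hu hpos hμ ha
            (by linarith) hx) _
      _ = _ := by
          rw [mul_left_comm, ← ENNReal.ofReal_mul (by positivity), ← mul_assoc,
            ← Real.rpow_add hx, show -(α + 1) + (a + α + 1 - a) = 0 by ring, Real.rpow_zero,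
            one_mul]
  · calc ∫⁻ t in {t : Ico (0 : ℝ) 1 | 1 - (t : ℝ) ≤ 1 - r}ᶜ,
          ENNReal.ofReal ((1 - (t : ℝ)) ^ (-a) * ((1 - r) * (1 - t * r) ^ (-(α + 2)))) ∂μ
        ≤ ∫⁻ t in {t : Ico (0 : ℝ) 1 | 1 - (t : ℝ) ≤ 1 - r}ᶜ,
          ENNReal.ofReal (1 - r) * ENNReal.ofReal ((1 - (t : ℝ)) ^ (-(a + α + 2))) ∂μ := by
          refine lintegral_mono fun t => ?_
          simp only
          rw [← ENNReal.ofReal_mul hx.le, mul_left_comm]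
          refine ENNReal.ofReal_le_ofReal (mul_le_mul_of_nonneg_left ?_ hx.le)
          calc (1 - (t : ℝ)) ^ (-a) * (1 - t * r) ^ (-(α + 2))
              ≤ (1 - (t : ℝ)) ^ (-a) * (1 - (t : ℝ)) ^ (-(α + 2)) :=
                mul_le_mul_of_nonneg_left
                  (Real.rpow_le_rpow_of_nonpos (hpos t) (hle1 t) (by linarith))
                  (Real.rpow_nonneg (hpos t).le _)
            _ = (1 - (t : ℝ)) ^ (-(a + α + 2)) := by
                rw [← Real.rpow_add (hpos t)]; ring_nf
      _ ≤ ENNReal.ofReal (1 - r) *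
          (K * ENNReal.ofReal ((1 - r) ^ (a + α + 1 - (a + α + 2)) *
            (2 ^ (a + α + 1) / (1 - 2 ^ (a + α + 1 - (a + α + 2)))))) := by
          rw [lintegral_const_mul' _ _ ENNReal.ofReal_ne_top]
          exact mul_le_mul_right (setLIntegral_compl_rpow_neg_le_of_carleson hu hμ
            (by linarith) (by linarith) hx) _
      _ = _ := by
          rw [mul_left_comm, ← ENNReal.ofReal_mul hx.le, ← mul_assoc]
          nth_rewrite 1 [← Real.rpow_one (1 - r)]
          rw [← Real.rpow_add hx, show (1 : ℝ) + (a + α + 1 - (a + α + 2)) = 0 by ring,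
            Real.rpow_zero, one_mul]

/-- The part of a vanishing Carleson measure near `1` is a Carleson measure with small
constant. -/
theorem IsVanishingCarleson.exists_restrict_le {μ : Measure (Ico (0 : ℝ) 1)} {s : ℝ}
    (hs : 0 ≤ s) (h : IsVanishingCarleson s μ) {ε : ℝ≥0∞} (hε : 0 < ε) :
    ∃ ρ : ℝ, ρ < 1 ∧ ∀ x : ℝ, 0 < x →
      μ.restrict {t | ρ ≤ (t : ℝ)} {t | 1 - (t : ℝ) ≤ x} ≤ ε * ENNReal.ofReal (x ^ s) := by
  have h1 : ∀ᶠ t in 𝓝[<] (1 : ℝ),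
      μ {x | t ≤ (x : ℝ)} / ENNReal.ofReal ((1 - t) ^ s) ≤ ε :=
    (ENNReal.tendsto_nhds_zero.1 h) ε hε
  obtain ⟨ρ, hρ, hρ'⟩ := (mem_nhdsLT_iff_exists_Ico_subset).1 h1
  have hle : ∀ t ∈ Ico ρ 1, μ {x | t ≤ (x : ℝ)} ≤ ε * ENNReal.ofReal ((1 - t) ^ s) := by
    intro t ht
    have h2 : 0 < (1 - t) ^ s := Real.rpow_pos_of_pos (by linarith [ht.2]) s
    exact (ENNReal.div_le_iff (ENNReal.ofReal_pos.2 h2).ne' ENNReal.ofReal_ne_top).1 (hρ' ht)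
  refine ⟨ρ, hρ, fun x hx => ?_⟩
  have hm : MeasurableSet {t : Ico (0 : ℝ) 1 | 1 - (t : ℝ) ≤ x} :=
    (by fun_prop : Measurable fun t : Ico (0 : ℝ) 1 => 1 - (t : ℝ)) measurableSet_Iic
  rw [Measure.restrict_apply hm]
  rcases le_total ρ (1 - x) with hc | hc
  · refine (measure_mono fun t ht => ?_).trans
      ((hle (1 - x) ⟨hc, by linarith⟩).trans_eq (by rw [sub_sub_cancel]))
    have : 1 - (t : ℝ) ≤ x := ht.1
    show 1 - x ≤ (t : ℝ)
    linarith
  · refine (measure_mono fun t ht => ht.2).trans ((hle ρ ⟨le_rfl, hρ⟩).trans ?_)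
    have hρ1 : ρ < 1 := hρ
    gcongr
    linarith

section KernelOp

/-! ### The integral operator on functions of `t ∈ [0, 1)` -/

/-- The operator `h ↦ ∫ h(t) / (1 - t z)^(α+1) dμ(t)` on functions `h` on `[0,1)`. The operators
`hilbertOp` and `sublinearHilbertOp` are the cases where `h` is the restriction of `f`,
respectively of `‖f‖`. -/
noncomputable def kernelOp (α : ℝ) (μ : Measure (Ico (0 : ℝ) 1)) (h : Ico (0 : ℝ) 1 → ℂ)
    (z : ℂ) : ℂ :=
  ∫ t : Ico (0 : ℝ) 1, h t / (1 - ((t : ℝ) : ℂ) * z) ^ ((α + 1 : ℝ) : ℂ) ∂μ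

/-- The derivative of the kernel `(1 - t z)^(-(α+1))` with respect to `z`. -/
noncomputable def derivKernel (α : ℝ) (z : ℂ) (t : Ico (0 : ℝ) 1) : ℂ :=
  ((α + 1 : ℝ) : ℂ) * ((t : ℝ) : ℂ) * (1 - ((t : ℝ) : ℂ) * z) ^ ((-(α + 2) : ℝ) : ℂ)

variable {α : ℝ} {μ : Measure (Ico (0 : ℝ) 1)} {h : Ico (0 : ℝ) 1 → ℂ} {z : ℂ}

theorem one_sub_mul_norm_pos (hz : ‖z‖ < 1) (t : Ico (0 : ℝ) 1) : 0 < 1 - (t : ℝ) * ‖z‖ := by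
  nlinarith [t.2.1, t.2.2, norm_nonneg z]

theorem one_sub_mul_norm_le (t : Ico (0 : ℝ) 1) :
    1 - (t : ℝ) * ‖z‖ ≤ ‖1 - ((t : ℝ) : ℂ) * z‖ := by
  have h1 := norm_sub_norm_le (1 : ℂ) (((t : ℝ) : ℂ) * z)
  rwa [norm_one, norm_mul, Complex.norm_real, Real.norm_of_nonneg t.2.1] at h1

theorem one_sub_mul_mem_slitPlane (hz : ‖z‖ < 1) (t : Ico (0 : ℝ) 1) :
    1 - ((t : ℝ) : ℂ) * z ∈ Complex.slitPlane := by
  refine Or.inl ?_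
  have h1 : (((t : ℝ) : ℂ) * z).re ≤ (t : ℝ) * ‖z‖ := by
    refine (Complex.re_le_norm _).trans_eq ?_
    rw [norm_mul, Complex.norm_real, Real.norm_of_nonneg t.2.1]
  have := one_sub_mul_norm_pos hz t
  rw [Complex.sub_re, Complex.one_re]
  linarith

theorem norm_derivKernel_le (hα : -1 < α) (hz : ‖z‖ < 1) (t : Ico (0 : ℝ) 1) :
    ‖derivKernel α z t‖ ≤ (α + 1) * (1 - (t : ℝ) * ‖z‖) ^ (-(α + 2)) := by
  have hp := one_sub_mul_norm_pos hz t
  rw [derivKernel, norm_mul, norm_mul, Complex.norm_real, Complex.norm_real,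
    Real.norm_of_nonneg t.2.1, Real.norm_of_nonneg (by linarith), Complex.norm_cpow_real]
  have h1 : (α + 1) * (t : ℝ) ≤ α + 1 := mul_le_of_le_one_right (by linarith) t.2.2.le
  exact mul_le_mul h1
    (Real.rpow_le_rpow_of_nonpos hp (one_sub_mul_norm_le t) (by linarith))
    (by positivity) (by linarith)

theorem measurable_derivKernel : Measurable (derivKernel α z) := by
  unfold derivKernel; fun_prop

theorem hasDerivAt_kernel (hz : ‖z‖ < 1) (t : Ico (0 : ℝ) 1) :
    HasDerivAt (fun w : ℂ => h t / (1 - ((t : ℝ) : ℂ) * w) ^ ((α + 1 : ℝ) : ℂ))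
      (h t * derivKernel α z t) z := by
  have hs := one_sub_mul_mem_slitPlane hz t
  have h1 : HasDerivAt (fun w : ℂ => 1 - ((t : ℝ) : ℂ) * w) (-((t : ℝ) : ℂ)) z := by
    simpa using ((hasDerivAt_id z).const_mul ((t : ℝ) : ℂ)).const_sub 1
  have h2 := (h1.cpow_const (c := -((α + 1 : ℝ) : ℂ)) hs).const_mul (h t)
  have h3 : (fun w : ℂ => h t / (1 - ((t : ℝ) : ℂ) * w) ^ ((α + 1 : ℝ) : ℂ)) =
      fun w : ℂ => h t * (1 - ((t : ℝ) : ℂ) * w) ^ (-((α + 1 : ℝ) : ℂ)) := by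
    funext w; rw [Complex.cpow_neg, div_eq_mul_inv]
  rw [h3]
  refine h2.congr_deriv ?_
  have e : -((α + 1 : ℝ) : ℂ) - 1 = ((-(α + 2) : ℝ) : ℂ) := by push_cast; ring
  rw [derivKernel, e]
  ring

theorem norm_kernel_le (hα : -1 < α) (hz : ‖z‖ < 1) (t : Ico (0 : ℝ) 1) :
    ‖h t / (1 - ((t : ℝ) : ℂ) * z) ^ ((α + 1 : ℝ) : ℂ)‖ ≤ (1 - ‖z‖) ^ (-(α + 1)) * ‖h t‖ := by
  have hz' : 0 < 1 - ‖z‖ := by linarith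
  have hle : 1 - ‖z‖ ≤ ‖1 - ((t : ℝ) : ℂ) * z‖ :=
    le_trans (by nlinarith [t.2.1, t.2.2, norm_nonneg z]) (one_sub_mul_norm_le t)
  rw [norm_div, Complex.norm_cpow_real, div_eq_inv_mul, ← Real.rpow_neg (norm_nonneg _)]
  exact mul_le_mul_of_nonneg_right
    (Real.rpow_le_rpow_of_nonpos hz' hle (by linarith)) (norm_nonneg _)

theorem integrable_kernel (hα : -1 < α) (hh : Integrable h μ) (hz : ‖z‖ < 1) :
    Integrable (fun t : Ico (0 : ℝ) 1 =>
      h t / (1 - ((t : ℝ) : ℂ) * z) ^ ((α + 1 : ℝ) : ℂ)) μ := by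
  refine (hh.norm.const_mul ((1 - ‖z‖) ^ (-(α + 1)))).mono' ?_
    (ae_of_all _ fun t => norm_kernel_le hα hz t)
  simp only [div_eq_mul_inv]
  exact hh.aestronglyMeasurable.mul (Measurable.aestronglyMeasurable (by fun_prop))

theorem integrable_mul_derivKernel_and_hasDerivAt (hα : -1 < α) (hh : Integrable h μ)
    (hz : ‖z‖ < 1) :
    Integrable (fun t => h t * derivKernel α z t) μ ∧
      HasDerivAt (kernelOp α μ h) (∫ t, h t * derivKernel α z t ∂μ) z := by
  set R : ℝ := (1 + ‖z‖) / 2 with hR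
  have hR1 : R < 1 := by rw [hR]; linarith
  have hzR : ‖z‖ < R := by rw [hR]; linarith
  have hnhds : Metric.ball (0 : ℂ) R ∈ 𝓝 z := Metric.isOpen_ball.mem_nhds (by simpa using hzR)
  refine hasDerivAt_integral_of_dominated_loc_of_deriv_le (s := Metric.ball (0 : ℂ) R)
    (F := fun w t => h t / (1 - ((t : ℝ) : ℂ) * w) ^ ((α + 1 : ℝ) : ℂ))
    (F' := fun w t => h t * derivKernel α w t)
    (bound := fun t => ((α + 1) * (1 - R) ^ (-(α + 2))) * ‖h t‖) hnhds ?_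
    (integrable_kernel hα hh hz) ?_ ?_ (hh.norm.const_mul _) ?_
  · filter_upwards [hnhds] with w hw
    have hw' : ‖w‖ < 1 := (by simpa using hw : ‖w‖ < R).trans hR1
    exact (integrable_kernel hα hh hw').aestronglyMeasurable
  · exact hh.aestronglyMeasurable.mul measurable_derivKernel.aestronglyMeasurable
  · refine ae_of_all _ fun t w hw => ?_
    have hw0 : ‖w‖ < R := by simpa using hw
    have hw' : ‖w‖ < 1 := hw0.trans hR1
    rw [norm_mul, mul_comm]
    refine mul_le_mul_of_nonneg_right ((norm_derivKernel_le hα hw' t).trans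
      (mul_le_mul_of_nonneg_left (Real.rpow_le_rpow_of_nonpos (by linarith) ?_ (by linarith))
        (by linarith))) (norm_nonneg _)
    nlinarith [t.2.1, t.2.2, norm_nonneg w]
  · refine ae_of_all _ fun t w hw => hasDerivAt_kernel ?_ t
    exact (by simpa using hw : ‖w‖ < R).trans hR1

theorem hasDerivAt_kernelOp (hα : -1 < α) (hh : Integrable h μ) (hz : ‖z‖ < 1) :
    HasDerivAt (kernelOp α μ h) (∫ t, h t * derivKernel α z t ∂μ) z :=
  (integrable_mul_derivKernel_and_hasDerivAt hα hh hz).2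

theorem mem_unitDisk {z : ℂ} : z ∈ unitDisk ↔ ‖z‖ < 1 := by
  simp [unitDisk]

theorem differentiableOn_kernelOp (hα : -1 < α) (hh : Integrable h μ) :
    DifferentiableOn ℂ (kernelOp α μ h) unitDisk := fun _ hz =>
  (hasDerivAt_kernelOp hα hh (mem_unitDisk.1 hz)).differentiableAt.differentiableWithinAt

/-- The weighted derivative is controlled by an `L¹` norm over `t < ρ` and by the Carleson constant
of `μ` on `[ρ, 1)`. -/
theorem ofReal_mul_enorm_integral_derivKernel_le {a B ρ : ℝ} {K : ℝ≥0∞} (ha : 0 ≤ a)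
    (hα : -1 < α) (hB : 0 ≤ B) (hρ : ρ < 1) (hbound : ∀ t, ‖h t‖ ≤ B * (1 - (t : ℝ)) ^ (-a))
    (hμ : ∀ x : ℝ, 0 < x → μ.restrict {t | ρ ≤ (t : ℝ)} {t | 1 - (t : ℝ) ≤ x} ≤
      K * ENNReal.ofReal (x ^ (a + α + 1))) (hz : ‖z‖ < 1) :
    ENNReal.ofReal (1 - ‖z‖ ^ 2) * ‖∫ t, h t * derivKernel α z t ∂μ‖ₑ ≤
      ENNReal.ofReal (2 * (α + 1) * (1 - ρ) ^ (-(α + 2))) * ∫⁻ t, ‖h t‖ₑ ∂μ +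
        ENNReal.ofReal (2 * (α + 1) * B * kernelConst a α) * K := by
  have hmeas : MeasurableSet {t : Ico (0 : ℝ) 1 | ρ ≤ (t : ℝ)} :=
    measurable_subtype_coe measurableSet_Ici
  have hz' : 0 < 1 - ‖z‖ := by linarith
  have hC : 0 ≤ 2 * (α + 1) := by linarith
  have hpt : ∀ t, ENNReal.ofReal (1 - ‖z‖ ^ 2) * ‖h t * derivKernel α z t‖ₑ ≤
      ENNReal.ofReal (2 * (α + 1) * (‖h t‖ * ((1 - ‖z‖) * (1 - t * ‖z‖) ^ (-(α + 2))))) := by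
    intro t
    rw [← ofReal_norm, ← ENNReal.ofReal_mul (by nlinarith [norm_nonneg z])]
    refine ENNReal.ofReal_le_ofReal ?_
    have h1 : 1 - ‖z‖ ^ 2 ≤ 2 * (1 - ‖z‖) := by nlinarith [norm_nonneg z]
    have h2 := norm_derivKernel_le hα hz t
    rw [norm_mul]
    calc (1 - ‖z‖ ^ 2) * (‖h t‖ * ‖derivKernel α z t‖)
        ≤ (2 * (1 - ‖z‖)) * (‖h t‖ * ((α + 1) * (1 - (t : ℝ) * ‖z‖) ^ (-(α + 2)))) := by
          gcongr
      _ = _ := by ring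
  calc ENNReal.ofReal (1 - ‖z‖ ^ 2) * ‖∫ t, h t * derivKernel α z t ∂μ‖ₑ
      ≤ ENNReal.ofReal (1 - ‖z‖ ^ 2) * ∫⁻ t, ‖h t * derivKernel α z t‖ₑ ∂μ :=
        mul_le_mul_right (enorm_integral_le_lintegral_enorm _) _
    _ = ∫⁻ t, ENNReal.ofReal (1 - ‖z‖ ^ 2) * ‖h t * derivKernel α z t‖ₑ ∂μ :=
        (lintegral_const_mul' _ _ ENNReal.ofReal_ne_top).symm
    _ ≤ ∫⁻ t, ENNReal.ofReal
          (2 * (α + 1) * (‖h t‖ * ((1 - ‖z‖) * (1 - t * ‖z‖) ^ (-(α + 2))))) ∂μ :=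
        lintegral_mono hpt
    _ = ∫⁻ t in {t : Ico (0 : ℝ) 1 | ρ ≤ (t : ℝ)}ᶜ, ENNReal.ofReal
          (2 * (α + 1) * (‖h t‖ * ((1 - ‖z‖) * (1 - t * ‖z‖) ^ (-(α + 2))))) ∂μ +
        ∫⁻ t in {t : Ico (0 : ℝ) 1 | ρ ≤ (t : ℝ)}, ENNReal.ofReal
          (2 * (α + 1) * (‖h t‖ * ((1 - ‖z‖) * (1 - t * ‖z‖) ^ (-(α + 2))))) ∂μ := by
        exact ((add_comm _ _).trans (lintegral_add_compl _ hmeas)).symm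
    _ ≤ _ := by
        refine add_le_add ?_ ?_
        · refine le_trans (setLIntegral_mono' (g := fun t => ENNReal.ofReal
            (2 * (α + 1) * (1 - ρ) ^ (-(α + 2))) * ‖h t‖ₑ) hmeas.compl fun t ht => ?_) ?_
          · have ht' : (t : ℝ) < ρ := not_le.1 ht
            have h0 : 0 < 1 - ρ := by linarith
            rw [← ofReal_norm, ← ENNReal.ofReal_mul (by positivity)]
            refine ENNReal.ofReal_le_ofReal ?_
            have h1 : (1 - (t : ℝ) * ‖z‖) ^ (-(α + 2)) ≤ (1 - ρ) ^ (-(α + 2)) :=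
              Real.rpow_le_rpow_of_nonpos h0 (by nlinarith [t.2.1, norm_nonneg z]) (by linarith)
            have h2 : 0 ≤ (1 - (t : ℝ) * ‖z‖) ^ (-(α + 2)) :=
              Real.rpow_nonneg (one_sub_mul_norm_pos hz t).le _
            calc 2 * (α + 1) * (‖h t‖ * ((1 - ‖z‖) * (1 - t * ‖z‖) ^ (-(α + 2))))
                ≤ 2 * (α + 1) * (‖h t‖ * (1 * (1 - ρ) ^ (-(α + 2)))) := by
                  gcongr
                  linarith [norm_nonneg z]
              _ = _ := by ring
          · rw [lintegral_const_mul' _ _ ENNReal.ofReal_ne_top]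
            exact mul_le_mul_right (setLIntegral_le_lintegral _ _) _
        · refine le_trans (lintegral_mono (g := fun t : Ico (0 : ℝ) 1 => ENNReal.ofReal (2 * (α + 1) * B) *
            ENNReal.ofReal ((1 - (t : ℝ)) ^ (-a) *
              ((1 - ‖z‖) * (1 - t * ‖z‖) ^ (-(α + 2))))) fun t => ?_) ?_
          · simp only
            rw [← ENNReal.ofReal_mul (by positivity)]
            refine ENNReal.ofReal_le_ofReal ?_
            have h2 : 0 ≤ (1 - (t : ℝ) * ‖z‖) ^ (-(α + 2)) :=
              Real.rpow_nonneg (one_sub_mul_norm_pos hz t).le _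
            calc 2 * (α + 1) * (‖h t‖ * ((1 - ‖z‖) * (1 - t * ‖z‖) ^ (-(α + 2))))
                ≤ 2 * (α + 1) * ((B * (1 - (t : ℝ)) ^ (-a)) *
                    ((1 - ‖z‖) * (1 - t * ‖z‖) ^ (-(α + 2)))) := by
                  gcongr
                  exact hbound t
              _ = _ := by ring
          · rw [lintegral_const_mul' _ _ ENNReal.ofReal_ne_top,
              ENNReal.ofReal_mul (p := 2 * (α + 1) * B) (by positivity),
              mul_assoc (ENNReal.ofReal _), mul_comm _ K]
            exact mul_le_mul_right (lintegral_blochKernel_le ha hα hμ (norm_nonneg z) hz) _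

variable {a B : ℝ}

theorem lintegral_enorm_le_of_bound (hB : 0 ≤ B)
    (hbound : ∀ t, ‖h t‖ ≤ B * (1 - (t : ℝ)) ^ (-a)) :
    ∫⁻ t, ‖h t‖ₑ ∂μ ≤
      ENNReal.ofReal B * ∫⁻ t : Ico (0 : ℝ) 1, ENNReal.ofReal ((1 - (t : ℝ)) ^ (-a)) ∂μ := by
  rw [← lintegral_const_mul' _ _ ENNReal.ofReal_ne_top]
  refine lintegral_mono fun t => ?_
  simp only
  rw [← ENNReal.ofReal_mul hB, ← ofReal_norm]
  exact ENNReal.ofReal_le_ofReal (hbound t)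

theorem integrable_of_bound (hB : 0 ≤ B)
    (hμ : ∫⁻ t : Ico (0 : ℝ) 1, ENNReal.ofReal ((1 - (t : ℝ)) ^ (-a)) ∂μ < ∞)
    (hh : Measurable h) (hbound : ∀ t, ‖h t‖ ≤ B * (1 - (t : ℝ)) ^ (-a)) : Integrable h μ :=
  ⟨hh.aestronglyMeasurable,
    (lintegral_enorm_le_of_bound hB hbound).trans_lt (ENNReal.mul_lt_top ENNReal.ofReal_lt_top hμ)⟩

theorem tendsto_lintegral_enorm_zero
    (hμ : ∫⁻ t : Ico (0 : ℝ) 1, ENNReal.ofReal ((1 - (t : ℝ)) ^ (-a)) ∂μ < ∞)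
    {k : ℕ → Ico (0 : ℝ) 1 → ℂ} (hk : ∀ n, Measurable (k n))
    (hbound : ∀ n t, ‖k n t‖ ≤ B * (1 - (t : ℝ)) ^ (-a))
    (hlim : ∀ t, Tendsto (fun n => k n t) atTop (𝓝 0)) :
    Tendsto (fun n => ∫⁻ t, ‖k n t‖ₑ ∂μ) atTop (𝓝 0) := by
  have h0 : ∫⁻ _ : Ico (0 : ℝ) 1, (0 : ℝ≥0∞) ∂μ = 0 := by simp
  rw [← h0]
  refine tendsto_lintegral_of_dominated_convergence
    (fun t => ENNReal.ofReal (B * (1 - (t : ℝ)) ^ (-a))) (fun n => (hk n).enorm)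
    (fun n => ae_of_all _ fun t => ?_) ?_ (ae_of_all _ fun t => ?_)
  · simp only [← ofReal_norm]
    exact ENNReal.ofReal_le_ofReal (hbound n t)
  · rcases le_total 0 B with hB | hB
    · simp only [ENNReal.ofReal_mul hB]
      rw [lintegral_const_mul' _ _ ENNReal.ofReal_ne_top]
      exact (ENNReal.mul_lt_top ENNReal.ofReal_lt_top hμ).ne
    · have : ∀ t : Ico (0 : ℝ) 1, ENNReal.ofReal (B * (1 - (t : ℝ)) ^ (-a)) = 0 := fun t =>
        ENNReal.ofReal_of_nonpos (mul_nonpos_of_nonpos_of_nonneg hB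
          (Real.rpow_nonneg (by linarith [t.2.2]) _))
      simp [this]
  · have := (hlim t).enorm
    rwa [enorm_zero] at this

/-- Under the vanishing Carleson condition the operator maps dominated functions into the Bloch
space. -/
theorem kernelOp_mem_blochSpace (ha : 0 ≤ a) (hα : -1 < α) (hB : 0 ≤ B)
    (hμ : ∫⁻ t : Ico (0 : ℝ) 1, ENNReal.ofReal ((1 - (t : ℝ)) ^ (-a)) ∂μ < ∞)
    (hv : IsVanishingCarleson (a + α + 1) μ) (hh : Measurable h)
    (hbound : ∀ t, ‖h t‖ ≤ B * (1 - (t : ℝ)) ^ (-a)) : kernelOp α μ h ∈ blochSpace := by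
  have hint := integrable_of_bound hB hμ hh hbound
  refine ⟨differentiableOn_kernelOp hα hint, ENNReal.add_lt_top.2 ⟨enorm_lt_top, ?_⟩⟩
  obtain ⟨ρ, hρ, hρ'⟩ := hv.exists_restrict_le (by linarith) one_pos
  refine (iSup₂_le fun z hz => ?_ : _ ≤
    ENNReal.ofReal (2 * (α + 1) * (1 - ρ) ^ (-(α + 2))) * ∫⁻ t, ‖h t‖ₑ ∂μ +
      ENNReal.ofReal (2 * (α + 1) * B * kernelConst a α) * 1).trans_lt (ENNReal.add_lt_top.2
    ⟨ENNReal.mul_lt_top ENNReal.ofReal_lt_top hint.2,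
      ENNReal.mul_lt_top ENNReal.ofReal_lt_top ENNReal.one_lt_top⟩)
  rw [(hasDerivAt_kernelOp hα hint (mem_unitDisk.1 hz)).deriv]
  exact ofReal_mul_enorm_integral_derivKernel_le ha hα hB hρ hbound hρ' (mem_unitDisk.1 hz)

/-- Under the vanishing Carleson condition, dominated pointwise convergence on `[0, 1)` is turned
into convergence in the Bloch norm. -/
theorem tendsto_blochNorm_kernelOp_sub (ha : 0 ≤ a) (hα : -1 < α) (hB : 0 ≤ B)
    (hμ : ∫⁻ t : Ico (0 : ℝ) 1, ENNReal.ofReal ((1 - (t : ℝ)) ^ (-a)) ∂μ < ∞)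
    (hv : IsVanishingCarleson (a + α + 1) μ) {k : ℕ → Ico (0 : ℝ) 1 → ℂ}
    (hk : ∀ n, Measurable (k n)) (hh : Measurable h)
    (hkb : ∀ n t, ‖k n t‖ ≤ B * (1 - (t : ℝ)) ^ (-a))
    (hbound : ∀ t, ‖h t‖ ≤ B * (1 - (t : ℝ)) ^ (-a))
    (hlim : ∀ t, Tendsto (fun n => k n t) atTop (𝓝 (h t))) :
    Tendsto (fun n => blochNorm (kernelOp α μ (k n) - kernelOp α μ h)) atTop (𝓝 0) := by
  have hint := integrable_of_bound hB hμ hh hbound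
  have hintk : ∀ n, Integrable (k n) μ := fun n => integrable_of_bound hB hμ (hk n) (hkb n)
  have hdb : ∀ n t, ‖(k n - h) t‖ ≤ 2 * B * (1 - (t : ℝ)) ^ (-a) := fun n t => by
    have := norm_sub_le (k n t) (h t)
    rw [Pi.sub_apply]
    linarith [hkb n t, hbound t]
  have hL := tendsto_lintegral_enorm_zero hμ (fun n => (hk n).sub hh) hdb fun t => by
    simpa using (hlim t).sub_const (h t)
  have hzero : ∀ n, ‖(kernelOp α μ (k n) - kernelOp α μ h) 0‖ₑ ≤ ∫⁻ t, ‖(k n - h) t‖ₑ ∂μ := by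
    intro n
    have : (kernelOp α μ (k n) - kernelOp α μ h) 0 = ∫ t, (k n - h) t ∂μ := by
      simp only [Pi.sub_apply, kernelOp, mul_zero, sub_zero, Complex.one_cpow, div_one]
      rw [integral_sub (hintk n) hint]
    rw [this]
    exact enorm_integral_le_lintegral_enorm _
  have hderiv : ∀ n, ∀ z ∈ unitDisk, deriv (kernelOp α μ (k n) - kernelOp α μ h) z =
      ∫ t, (k n - h) t * derivKernel α z t ∂μ := by
    intro n z hz
    obtain ⟨h1, h1'⟩ := integrable_mul_derivKernel_and_hasDerivAt hα (hintk n) (mem_unitDisk.1 hz)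
    obtain ⟨h2, h2'⟩ := integrable_mul_derivKernel_and_hasDerivAt hα hint (mem_unitDisk.1 hz)
    rw [(h1'.sub h2').deriv, ← integral_sub h1 h2]
    simp only [Pi.sub_apply, sub_mul]
  have key : ∀ ε : ℝ≥0∞, 0 < ε → ∃ C : ℝ≥0∞, C ≠ ∞ ∧ ∀ n,
      blochNorm (kernelOp α μ (k n) - kernelOp α μ h) ≤
        (∫⁻ t, ‖(k n - h) t‖ₑ ∂μ + C * ∫⁻ t, ‖(k n - h) t‖ₑ ∂μ) +
          ENNReal.ofReal (2 * (α + 1) * (2 * B) * kernelConst a α) * ε := by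
    intro ε hε
    obtain ⟨ρ, hρ, hρ'⟩ := hv.exists_restrict_le (by linarith) hε
    refine ⟨_, ENNReal.ofReal_ne_top (r := 2 * (α + 1) * (1 - ρ) ^ (-(α + 2))), fun n => ?_⟩
    rw [blochNorm, add_assoc]
    refine add_le_add (hzero n) (iSup₂_le fun z hz => ?_)
    rw [hderiv n z hz]
    exact ofReal_mul_enorm_integral_derivKernel_le ha hα (by linarith) hρ (hdb n) hρ'
      (mem_unitDisk.1 hz)
  set c := ENNReal.ofReal (2 * (α + 1) * (2 * B) * kernelConst a α) with hc
  refine ENNReal.tendsto_nhds_zero.2 fun δ hδ => ?_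
  -- Half of the error is absorbed by the Carleson constant near `1`, half by convergence in `L¹`.
  have hδ2 : 0 < δ / 2 := ENNReal.half_pos hδ.ne'
  have hε : 0 < δ / 2 / (c + 1) :=
    ENNReal.div_pos hδ2.ne' (ENNReal.add_ne_top.2 ⟨ENNReal.ofReal_ne_top, ENNReal.one_ne_top⟩)
  obtain ⟨C, hC, hle⟩ := key _ hε
  have hlim0 : Tendsto (fun n => ∫⁻ t, ‖(k n - h) t‖ₑ ∂μ + C * ∫⁻ t, ‖(k n - h) t‖ₑ ∂μ) atTop
      (𝓝 0) := by
    simpa using hL.add (ENNReal.Tendsto.const_mul hL (Or.inr hC))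
  filter_upwards [(ENNReal.tendsto_nhds_zero.1 hlim0) (δ / 2) hδ2] with n hn
  refine (hle n).trans ((add_le_add hn ?_).trans_eq (ENNReal.add_halves δ))
  calc c * (δ / 2 / (c + 1)) ≤ (c + 1) * (δ / 2 / (c + 1)) :=
        mul_le_mul_left le_self_add _
    _ ≤ δ / 2 := ENNReal.mul_div_le

end KernelOp

/-! ### Extraction of a pointwise convergent subsequence -/

/-- A weak form of Montel's theorem: compactness of the product of the discs which contain the
Taylor coefficients gives a subsequence along which every coefficient converges, and the Taylor
series are dominated. -/
theorem exists_subseq_tendsto_of_locally_bounded {F : ℕ → ℂ → ℂ} {B : ℝ → ℝ}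
    (hF : ∀ n, DifferentiableOn ℂ (F n) unitDisk)
    (hB : ∀ n z, ‖z‖ < 1 → ‖F n z‖ ≤ B ‖z‖) :
    ∃ φ : ℕ → ℕ, StrictMono φ ∧
      ∀ z, ‖z‖ < 1 → ∃ l, Tendsto (fun n => F (φ n) z) atTop (𝓝 l) := by
  set c : ℕ → ℕ → ℂ := fun n k => (k.factorial : ℂ)⁻¹ • iteratedDeriv k (F n) 0 with hc
  have hcb : ∀ r : ℝ, 0 < r → r < 1 → ∀ n k, ‖c n k‖ ≤ B r / r ^ k := by
    intro r hr0 hr1 n k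
    have hd : DiffContOnCl ℂ (F n) (Metric.ball 0 r) :=
      ((hF n).mono (by
        rw [closure_ball _ hr0.ne']
        exact Metric.closedBall_subset_ball hr1)).diffContOnCl
    have h1 := Complex.norm_iteratedDeriv_le_of_forall_mem_sphere_norm_le k hr0 hd
      (C := B r) fun z hz => by
        have hz' : ‖z‖ = r := by simpa using hz
        rw [← hz']
        exact hB n z (hz' ▸ hr1)
    have hk : (0 : ℝ) < k.factorial := by positivity
    rw [hc, norm_smul, norm_inv, Complex.norm_natCast, inv_mul_le_iff₀ hk]
    refine h1.trans_eq (by ring)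
  have hK : IsCompact (univ.pi fun k : ℕ => Metric.closedBall (0 : ℂ) (B (1 / 2) / (1 / 2) ^ k)) :=
    isCompact_univ_pi fun k => isCompact_closedBall _ _
  obtain ⟨c₀, -, φ, hφ, hlim⟩ := hK.tendsto_subseq (x := c) fun n k _ => by
    simpa using hcb (1 / 2) (by norm_num) (by norm_num) n k
  refine ⟨φ, hφ, fun z hz => ⟨∑' k, z ^ k * c₀ k, ?_⟩⟩
  set r : ℝ := (1 + ‖z‖) / 2 with hr
  have hr1 : r < 1 := by rw [hr]; linarith
  have hzr : ‖z‖ < r := by rw [hr]; linarith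
  have hr0 : 0 < r := (norm_nonneg z).trans_lt hzr
  have hsum : ∀ n, F (φ n) z = ∑' k, z ^ k * c (φ n) k := by
    intro n
    have h1 := Complex.hasSum_taylorSeries_on_ball (f := F (φ n)) (c := 0) (r := 1) (hF (φ n))
      (z := z) (by simpa using hz)
    rw [← h1.tsum_eq]
    refine tsum_congr fun k => ?_
    simp only [hc, sub_zero, smul_eq_mul]
    ring
  simp only [hsum]
  refine tendsto_tsum_of_dominated_convergence (bound := fun k => B r * (‖z‖ / r) ^ k)
    ((summable_geometric_of_lt_one (by positivity) ((div_lt_one hr0).2 hzr)).mul_left _)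
    (fun k => ((tendsto_pi_nhds.1 hlim k).const_mul (z ^ k))) (Eventually.of_forall fun n k => ?_)
  rw [norm_mul, norm_pow, div_pow]
  calc ‖z‖ ^ k * ‖c (φ n) k‖ ≤ ‖z‖ ^ k * (B r / r ^ k) := by
        gcongr; exact hcb r hr0 hr1 (φ n) k
    _ = B r * (‖z‖ ^ k / r ^ k) := by ring

theorem measurable_comp_coe {f : ℂ → ℂ} (hf : DifferentiableOn ℂ f unitDisk) :
    Measurable fun t : Ico (0 : ℝ) 1 => f ((t : ℝ) : ℂ) := by
  refine Continuous.measurable (hf.continuousOn.comp_continuous (by fun_prop) fun t => ?_)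
  rw [mem_unitDisk, Complex.norm_real, Real.norm_of_nonneg t.2.1]
  exact t.2.2

theorem norm_comp_coe_le {p : ℝ} (hp : 0 < p) {f : ℂ → ℂ} {M : ℝ≥0}
    (hf : DifferentiableOn ℂ f unitDisk) (hM : bergmanNorm p f ≤ M) (t : Ico (0 : ℝ) 1) :
    ‖f ((t : ℝ) : ℂ)‖ ≤ M * (1 - (t : ℝ)) ^ (-(2 / p)) := by
  have h1 : ‖((t : ℝ) : ℂ)‖ = t := by rw [Complex.norm_real, Real.norm_of_nonneg t.2.1]
  have h2 := norm_le_of_bergmanNorm_le hp hf hM (z := ((t : ℝ) : ℂ)) (by rw [h1]; exact t.2.2)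
  rwa [h1] at h2

/-- Sufficiency of the vanishing Carleson condition, for the composition of `kernelOp` with a
continuous pointwise modification `q` of `f` that preserves the modulus. -/
theorem isCompactBergmanToBloch_of_isVanishingCarleson {p α : ℝ} (hp : 0 < p) (hα : -1 < α)
    {μ : Measure (Ico (0 : ℝ) 1)}
    (hμ : ∫⁻ t : Ico (0 : ℝ) 1, ENNReal.ofReal ((1 - (t : ℝ)) ^ (-(2 / p))) ∂μ < ∞)
    (hv : IsVanishingCarleson (2 / p + α + 1) μ) {q : ℂ → ℂ} (hq : Continuous q)
    (hqn : ∀ w, ‖q w‖ = ‖w‖) :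
    IsCompactBergmanToBloch p fun f => kernelOp α μ fun t => q (f ((t : ℝ) : ℂ)) := by
  have ha : 0 ≤ 2 / p := by positivity
  refine ⟨fun f hf => ?_, fun f hf ⟨M, hM⟩ => ?_⟩
  · refine kernelOp_mem_blochSpace ha hα (B := (bergmanNorm p f).toNNReal) NNReal.zero_le_coe hμ hv
      (hq.measurable.comp (measurable_comp_coe hf.1)) fun t => ?_
    rw [hqn]
    exact norm_comp_coe_le hp hf.1 (ENNReal.coe_toNNReal hf.2.ne).ge t
  · obtain ⟨φ, hφ, hlim⟩ := exists_subseq_tendsto_of_locally_bounded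
      (B := fun r => M * (1 - r) ^ (-(2 / p))) (fun n => (hf n).1)
      fun n z hz => norm_le_of_bergmanNorm_le hp (hf n).1 (hM n) hz
    have hlim' : ∀ t : Ico (0 : ℝ) 1, ∃ l,
        Tendsto (fun n => f (φ n) ((t : ℝ) : ℂ)) atTop (𝓝 l) := fun t =>
      hlim _ (by rw [Complex.norm_real, Real.norm_of_nonneg t.2.1]; exact t.2.2)
    choose l hl using hlim'
    have hlm : Measurable l := measurable_of_tendsto_metrizable
      (fun n => measurable_comp_coe (hf (φ n)).1) (tendsto_pi_nhds.2 hl)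
    have hlb : ∀ t, ‖q (l t)‖ ≤ M * (1 - (t : ℝ)) ^ (-(2 / p)) := fun t => by
      rw [hqn]
      exact le_of_tendsto (hl t).norm
        (Eventually.of_forall fun n => norm_comp_coe_le hp (hf (φ n)).1 (hM (φ n)) t)
    refine ⟨φ, hφ, kernelOp α μ (fun t => q (l t)),
      kernelOp_mem_blochSpace ha hα M.coe_nonneg hμ hv (hq.measurable.comp hlm) hlb, ?_⟩
    refine tendsto_blochNorm_kernelOp_sub ha hα M.coe_nonneg hμ hv
      (fun n => hq.measurable.comp (measurable_comp_coe (hf (φ n)).1)) (hq.measurable.comp hlm)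
      (fun n t => ?_) hlb fun t => (hq.tendsto _).comp (hl t)
    rw [hqn]
    exact norm_comp_coe_le hp (hf (φ n)).1 (hM (φ n)) t

/-! ### Test functions -/

theorem det_smul_one (c : ℂ) : (c • (1 : ℂ →L[ℝ] ℂ)).det = ‖c‖ ^ 2 := by
  rw [← Complex.normSq_eq_norm_sq, ← Algebra.norm_complex_apply, Algebra.norm_apply]
  rfl

/-- The Möbius map `z ↦ (z - b) / (1 - b z)` sends the disk injectively into itself, so its
Jacobian has integral at most the area of the disk. -/
theorem lintegral_mobius_jacobian_le (b : Ico (0 : ℝ) 1) :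
    ∫⁻ z, ENNReal.ofReal (((1 - (b : ℝ) ^ 2) / ‖1 - ((b : ℝ) : ℂ) * z‖ ^ 2) ^ 2) ∂areaMeasure ≤
      1 := by
  have hb2 : 0 < 1 - (b : ℝ) ^ 2 := by nlinarith [b.2.1, b.2.2]
  have hne : ∀ z ∈ unitDisk, 1 - ((b : ℝ) : ℂ) * z ≠ 0 := fun z hz =>
    Complex.slitPlane_ne_zero (one_sub_mul_mem_slitPlane (mem_unitDisk.1 hz) b)
  set ψ : ℂ → ℂ := fun z => (z - ((b : ℝ) : ℂ)) / (1 - ((b : ℝ) : ℂ) * z) with hψ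
  set c : ℂ → ℂ := fun z => ((1 - (b : ℝ) ^ 2 : ℝ) : ℂ) / (1 - ((b : ℝ) : ℂ) * z) ^ 2 with hc
  have hderiv : ∀ z ∈ unitDisk,
      HasFDerivWithinAt ψ (c z • (1 : ℂ →L[ℝ] ℂ)) unitDisk z := by
    intro z hz
    have h1 : HasDerivAt (fun w : ℂ => 1 - ((b : ℝ) : ℂ) * w) (-((b : ℝ) : ℂ)) z := by
      simpa using ((hasDerivAt_id z).const_mul ((b : ℝ) : ℂ)).const_sub 1
    have h2 := ((hasDerivAt_id z).sub_const ((b : ℝ) : ℂ)).div h1 (hne z hz)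
    have h3 : HasDerivAt ψ (c z) z := by
      refine h2.congr_deriv ?_
      simp only [hc, id]
      push_cast
      congr 1
      ring
    exact h3.complexToReal_fderiv.hasFDerivWithinAt
  have hinj : InjOn ψ unitDisk := by
    intro z hz w hw hzw
    simp only [hψ] at hzw
    rw [div_eq_div_iff (hne z hz) (hne w hw)] at hzw
    have h1 : ((1 - (b : ℝ) ^ 2 : ℝ) : ℂ) * (z - w) = 0 := by
      push_cast; linear_combination hzw
    rcases mul_eq_zero.1 h1 with h | h
    · exact absurd (Complex.ofReal_eq_zero.1 h) hb2.ne'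
    · exact sub_eq_zero.1 h
  have hmaps : ψ '' unitDisk ⊆ unitDisk := by
    rintro _ ⟨z, hz, rfl⟩
    have hz1 := mem_unitDisk.1 hz
    rw [mem_unitDisk]
    simp only [hψ]
    rw [norm_div, div_lt_one (norm_pos_iff.2 (hne z hz)), ← sq_lt_sq₀ (norm_nonneg _)
      (norm_nonneg _), ← Complex.normSq_eq_norm_sq, ← Complex.normSq_eq_norm_sq]
    have hz2 : Complex.normSq z < 1 := by
      rw [Complex.normSq_eq_norm_sq]; nlinarith [norm_nonneg z]
    rw [Complex.normSq_apply] at hz2 ⊢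
    rw [Complex.normSq_apply]
    simp only [Complex.sub_re, Complex.sub_im, Complex.ofReal_re, Complex.ofReal_im,
      Complex.one_re, Complex.one_im, Complex.mul_re, Complex.mul_im]
    nlinarith [mul_pos hb2 (sub_pos.2 hz2)]
  have hm : MeasurableSet unitDisk := Metric.isOpen_ball.measurableSet
  have key := lintegral_abs_det_fderiv_eq_addHaar_image volume hm hderiv hinj
  rw [areaMeasure, lintegral_smul_measure, smul_eq_mul]
  have hcongr : ∫⁻ z in unitDisk,
      ENNReal.ofReal (((1 - (b : ℝ) ^ 2) / ‖1 - ((b : ℝ) : ℂ) * z‖ ^ 2) ^ 2) =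
      ∫⁻ z in unitDisk, ENNReal.ofReal |(c z • (1 : ℂ →L[ℝ] ℂ)).det| := by
    refine lintegral_congr fun z => ?_
    rw [det_smul_one, abs_of_nonneg (by positivity)]
    simp only [hc]
    rw [norm_div, norm_pow, Complex.norm_real, Real.norm_of_nonneg hb2.le]
  rw [hcongr, key]
  calc ENNReal.ofReal Real.pi⁻¹ * volume (ψ '' unitDisk)
      ≤ ENNReal.ofReal Real.pi⁻¹ * volume unitDisk := mul_le_mul_right (measure_mono hmaps) _
    _ = 1 := by
      rw [unitDisk, Complex.volume_ball, ENNReal.ofReal_one, one_pow, one_mul,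
        ← NNReal.coe_real_pi, ← NNReal.coe_inv, ENNReal.ofReal_coe_nnreal,
        ENNReal.coe_inv NNReal.pi_ne_zero]
      exact ENNReal.inv_mul_cancel (by simpa using NNReal.pi_ne_zero) ENNReal.coe_ne_top

/-- The test function `(1 - b²)^(2/p) / (1 - b z)^(4/p)`, a power of the derivative of a disk
automorphism, normalized so that `|f|^p` is the Jacobian of that automorphism. -/
noncomputable def testFun (p : ℝ) (b : Ico (0 : ℝ) 1) (z : ℂ) : ℂ :=
  (((1 - (b : ℝ) ^ 2) ^ (2 / p) : ℝ) : ℂ) * (1 - ((b : ℝ) : ℂ) * z) ^ ((-(4 / p) : ℝ) : ℂ)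

/-- The values of `testFun` on `[0, 1)`. -/
noncomputable def testVal (p : ℝ) (b t : Ico (0 : ℝ) 1) : ℝ :=
  (1 - (b : ℝ) ^ 2) ^ (2 / p) * (1 - (b : ℝ) * t) ^ (-(4 / p))

variable {p : ℝ} (b t : Ico (0 : ℝ) 1)

theorem one_sub_mul_pos : 0 < 1 - (b : ℝ) * t := by
  nlinarith [b.2.1, b.2.2, t.2.1, t.2.2]

theorem one_sub_sq_pos : 0 < 1 - (b : ℝ) ^ 2 := by
  nlinarith [b.2.1, b.2.2]

theorem testVal_nonneg : 0 ≤ testVal p b t :=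
  mul_nonneg (Real.rpow_nonneg (one_sub_sq_pos b).le _) (Real.rpow_nonneg (one_sub_mul_pos b t).le _)

theorem testFun_coe : testFun p b ((t : ℝ) : ℂ) = (testVal p b t : ℂ) := by
  rw [testFun, testVal, Complex.ofReal_mul, Complex.ofReal_cpow (one_sub_mul_pos b t).le]
  push_cast
  rfl

theorem measurable_testVal : Measurable (testVal p b) := by
  unfold testVal; fun_prop

theorem differentiableOn_testFun : DifferentiableOn ℂ (testFun p b) unitDisk := by
  intro z hz
  have h1 : DifferentiableAt ℂ (fun w : ℂ => 1 - ((b : ℝ) : ℂ) * w) z := by fun_prop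
  exact ((h1.cpow_const (one_sub_mul_mem_slitPlane (mem_unitDisk.1 hz) b)).const_mul
    _).differentiableWithinAt

theorem norm_testFun_rpow (hp : 0 < p) (z : ℂ) :
    ‖testFun p b z‖ ^ p = ((1 - (b : ℝ) ^ 2) / ‖1 - ((b : ℝ) : ℂ) * z‖ ^ 2) ^ 2 := by
  have hb2 := one_sub_sq_pos b
  rw [testFun, norm_mul, Complex.norm_real, Real.norm_of_nonneg (by positivity),
    Complex.norm_cpow_real, Real.mul_rpow (by positivity) (by positivity),
    ← Real.rpow_mul hb2.le, ← Real.rpow_mul (norm_nonneg _), div_mul_cancel₀ _ hp.ne',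
    show -(4 / p) * p = -(4 : ℕ) by field_simp; norm_num, Real.rpow_neg (norm_nonneg _),
    Real.rpow_natCast, Real.rpow_two, div_pow, ← pow_mul, div_eq_mul_inv]

theorem bergmanNorm_testFun_le (hp : 0 < p) : bergmanNorm p (testFun p b) ≤ 1 := by
  have h0 : ENNReal.ofReal p ≠ 0 := by simpa using hp
  rw [bergmanNorm, eLpNorm_eq_lintegral_rpow_enorm_toReal h0 ENNReal.ofReal_ne_top,
    ENNReal.toReal_ofReal hp.le]
  refine ENNReal.rpow_le_one ?_ (by positivity)
  refine le_of_eq_of_le (lintegral_congr fun z => ?_) (lintegral_mobius_jacobian_le b)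
  rw [← ofReal_norm, ENNReal.ofReal_rpow_of_nonneg (norm_nonneg _) hp.le, norm_testFun_rpow b hp]

theorem testVal_le (hp : 0 < p) :
    testVal p b t ≤ 2 ^ (2 / p) * (1 - (t : ℝ)) ^ (-(2 / p)) := by
  have h1 := one_sub_mul_pos b t
  have ht : 0 < 1 - (t : ℝ) := by linarith [t.2.2]
  have hbt : 1 - (b : ℝ) ≤ 1 - b * t := by nlinarith [b.2.1, t.2.2]
  have htb : 1 - (t : ℝ) ≤ 1 - b * t := by nlinarith [b.2.2, t.2.1]
  calc testVal p b t ≤ (2 * (1 - (b : ℝ) * t)) ^ (2 / p) * (1 - (b : ℝ) * t) ^ (-(4 / p)) := by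
        refine mul_le_mul_of_nonneg_right (Real.rpow_le_rpow (one_sub_sq_pos b).le ?_
          (by positivity)) (Real.rpow_nonneg h1.le _)
        nlinarith [b.2.1, b.2.2]
    _ = 2 ^ (2 / p) * (1 - (b : ℝ) * t) ^ (-(2 / p)) := by
        rw [Real.mul_rpow (by norm_num) h1.le, mul_assoc, ← Real.rpow_add h1]
        congr 2
        ring
    _ ≤ _ := mul_le_mul_of_nonneg_left
        (Real.rpow_le_rpow_of_nonpos ht htb (by
          have : 0 < 2 / p := by positivity
          linarith)) (by positivity)

theorem tendsto_testVal_zero (hp : 0 < p) {b : ℕ → Ico (0 : ℝ) 1}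
    (hb : Tendsto (fun n => (b n : ℝ)) atTop (𝓝 1)) :
    Tendsto (fun n => testVal p (b n) t) atTop (𝓝 0) := by
  have h4 : 0 < 4 / p := by positivity
  have hlim : Tendsto (fun n => (1 - (b n : ℝ) ^ 2) ^ (2 / p) * (1 - (t : ℝ)) ^ (-(4 / p)))
      atTop (𝓝 0) := by
    have h1 : Tendsto (fun n => 1 - (b n : ℝ) ^ 2) atTop (𝓝 0) := by
      simpa using (hb.pow 2).const_sub 1
    have h2 := (h1.rpow_const (p := 2 / p) (Or.inr (by positivity))).mul_const
      ((1 - (t : ℝ)) ^ (-(4 / p)))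
    rwa [Real.zero_rpow (by positivity), zero_mul] at h2
  refine squeeze_zero (fun n => testVal_nonneg (b n) t) (fun n => ?_) hlim
  refine mul_le_mul_of_nonneg_left (Real.rpow_le_rpow_of_nonpos (by linarith [t.2.2]) ?_
    (by linarith)) (Real.rpow_nonneg (one_sub_sq_pos (b n)).le _)
  nlinarith [(b n).2.2, t.2.1]

/-! ### Necessity of the Carleson condition -/

variable {α : ℝ} {μ : Measure (Ico (0 : ℝ) 1)}

theorem derivKernel_coe :
    derivKernel α ((b : ℝ) : ℂ) t =
      (((α + 1) * (t : ℝ) * (1 - (t : ℝ) * b) ^ (-(α + 2)) : ℝ) : ℂ) := by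
  rw [derivKernel, Complex.ofReal_mul, Complex.ofReal_mul,
    Complex.ofReal_cpow (one_sub_mul_pos t b).le]
  push_cast
  rfl

/-- The weighted derivative at `b` of the image of the test function dominates the Carleson
quotient at `b`. -/
theorem mul_carlesonQuotient_le (hp : 0 < p) (hα : -1 < α) (hb : 1 / 2 ≤ (b : ℝ))
    (hint : Integrable (fun t => (testVal p b t : ℂ) * derivKernel α ((b : ℝ) : ℂ) t) μ) :
    ENNReal.ofReal ((α + 1) / 2 * 2 ^ (-(2 / p + α + 1))) *
        (μ {x | (b : ℝ) ≤ (x : ℝ)} / ENNReal.ofReal ((1 - (b : ℝ)) ^ (2 / p + α + 1))) ≤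
      ENNReal.ofReal (1 - ‖((b : ℝ) : ℂ)‖ ^ 2) *
        ‖∫ t, (testVal p b t : ℂ) * derivKernel α ((b : ℝ) : ℂ) t ∂μ‖ₑ := by
  set s : ℝ := 2 / p + α + 1 with hs
  have h2p : 0 < 2 / p := by positivity
  have hb2 := one_sub_sq_pos b
  have hb1 : 0 < 1 - (b : ℝ) := by linarith [b.2.2]
  set G : Ico (0 : ℝ) 1 → ℝ := fun t =>
    testVal p b t * ((α + 1) * (t : ℝ) * (1 - (t : ℝ) * b) ^ (-(α + 2))) with hG
  have hGeq : (fun t => (testVal p b t : ℂ) * derivKernel α ((b : ℝ) : ℂ) t) =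
      fun t => ((G t : ℝ) : ℂ) := by
    funext t
    rw [derivKernel_coe, hG]
    push_cast
    rfl
  have hG0 : ∀ t, 0 ≤ G t := fun t => mul_nonneg (testVal_nonneg b t)
    (mul_nonneg (mul_nonneg (by linarith) t.2.1) (Real.rpow_nonneg (one_sub_mul_pos t b).le _))
  rw [hGeq] at hint ⊢
  have hGint : Integrable G μ := by simpa using hint.re
  have hnorm : ‖∫ t, ((G t : ℝ) : ℂ) ∂μ‖ₑ = ∫⁻ t, ENNReal.ofReal (G t) ∂μ := by
    rw [integral_complex_ofReal, ← ofReal_norm, Complex.norm_real,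
      Real.norm_of_nonneg (integral_nonneg hG0),
      ofReal_integral_eq_lintegral_ofReal hGint (ae_of_all _ hG0)]
  have hm : MeasurableSet {x : Ico (0 : ℝ) 1 | (b : ℝ) ≤ (x : ℝ)} :=
    measurable_subtype_coe measurableSet_Ici
  -- On `[b, 1)` both `1 - b t` and `1 - b²` are comparable with `1 - b`.
  have hGlow : ∀ t : Ico (0 : ℝ) 1, (b : ℝ) ≤ t →
      (α + 1) / 2 * (1 - (b : ℝ) ^ 2) ^ (-s - 1) ≤ G t := by
    intro t ht
    have h1 := one_sub_mul_pos b t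
    have hle : 1 - (b : ℝ) * t ≤ 1 - (b : ℝ) ^ 2 := by nlinarith [b.2.1]
    have hv : (1 - (b : ℝ) ^ 2) ^ (-(2 / p)) ≤ testVal p b t := by
      calc (1 - (b : ℝ) ^ 2) ^ (-(2 / p))
          = (1 - (b : ℝ) ^ 2) ^ (2 / p) * (1 - (b : ℝ) ^ 2) ^ (-(4 / p)) := by
            rw [← Real.rpow_add hb2]; congr 1; ring
        _ ≤ _ := mul_le_mul_of_nonneg_left (Real.rpow_le_rpow_of_nonpos h1 hle (by
            have : 0 < 4 / p := by positivity
            linarith)) (by positivity)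
    have hk : (α + 1) / 2 * (1 - (b : ℝ) ^ 2) ^ (-(α + 2)) ≤
        (α + 1) * (t : ℝ) * (1 - (t : ℝ) * b) ^ (-(α + 2)) := by
      refine mul_le_mul ?_ (Real.rpow_le_rpow_of_nonpos (one_sub_mul_pos t b)
        (by linarith) (by linarith)) (by positivity)
        (mul_nonneg (by linarith) t.2.1)
      nlinarith
    calc (α + 1) / 2 * (1 - (b : ℝ) ^ 2) ^ (-s - 1)
        = (1 - (b : ℝ) ^ 2) ^ (-(2 / p)) * ((α + 1) / 2 * (1 - (b : ℝ) ^ 2) ^ (-(α + 2))) := by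
          rw [mul_left_comm, ← Real.rpow_add hb2, hs]
          congr 2
          ring
      _ ≤ G t := mul_le_mul hv hk
          (mul_nonneg (by linarith) (by positivity)) (testVal_nonneg b t)
  have hcmp : (α + 1) / 2 * 2 ^ (-s) * ((1 - (b : ℝ)) ^ s)⁻¹ ≤
      (1 - (b : ℝ) ^ 2) * ((α + 1) / 2 * (1 - (b : ℝ) ^ 2) ^ (-s - 1)) := by
    have e1 : (1 - (b : ℝ) ^ 2) * ((α + 1) / 2 * (1 - (b : ℝ) ^ 2) ^ (-s - 1)) =
        (α + 1) / 2 * (1 - (b : ℝ) ^ 2) ^ (-s) := by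
      rw [Real.rpow_sub_one hb2.ne']
      field_simp
    rw [e1, ← Real.rpow_neg hb1.le, mul_assoc, ← Real.mul_rpow (by norm_num) hb1.le]
    refine mul_le_mul_of_nonneg_left (Real.rpow_le_rpow_of_nonpos hb2 ?_ (by linarith))
      (by linarith)
    nlinarith [b.2.1, b.2.2]
  have hbs : 0 < (1 - (b : ℝ)) ^ s := Real.rpow_pos_of_pos hb1 s
  rw [hnorm, Complex.norm_real, Real.norm_of_nonneg b.2.1]
  calc ENNReal.ofReal ((α + 1) / 2 * 2 ^ (-s)) *
        (μ {x | (b : ℝ) ≤ (x : ℝ)} / ENNReal.ofReal ((1 - (b : ℝ)) ^ s))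
      = ENNReal.ofReal ((α + 1) / 2 * 2 ^ (-s) * ((1 - (b : ℝ)) ^ s)⁻¹) *
          μ {x | (b : ℝ) ≤ (x : ℝ)} := by
        rw [ENNReal.ofReal_mul (q := ((1 - (b : ℝ)) ^ s)⁻¹)
          (mul_nonneg (by linarith) (by positivity)), ENNReal.ofReal_inv_of_pos hbs,
          ENNReal.div_eq_inv_mul, mul_assoc]
    _ ≤ ENNReal.ofReal ((1 - (b : ℝ) ^ 2) * ((α + 1) / 2 * (1 - (b : ℝ) ^ 2) ^ (-s - 1))) *
          μ {x | (b : ℝ) ≤ (x : ℝ)} := mul_le_mul_left (ENNReal.ofReal_le_ofReal hcmp) _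
    _ = ENNReal.ofReal (1 - (b : ℝ) ^ 2) * ∫⁻ _ in {x : Ico (0 : ℝ) 1 | (b : ℝ) ≤ (x : ℝ)},
          ENNReal.ofReal ((α + 1) / 2 * (1 - (b : ℝ) ^ 2) ^ (-s - 1)) ∂μ := by
        rw [setLIntegral_const, ENNReal.ofReal_mul hb2.le, mul_assoc]
    _ ≤ ENNReal.ofReal (1 - (b : ℝ) ^ 2) * ∫⁻ t, ENNReal.ofReal (G t) ∂μ := by
        refine mul_le_mul_right ((setLIntegral_mono' hm fun t ht =>
          ENNReal.ofReal_le_ofReal (hGlow t ht)).trans (setLIntegral_le_lintegral _ _)) _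

theorem enorm_integral_derivKernel_le {h : Ico (0 : ℝ) 1 → ℂ} {z : ℂ} (hα : -1 < α)
    (hz : ‖z‖ < 1) :
    ‖∫ t, h t * derivKernel α z t ∂μ‖ₑ ≤
      ENNReal.ofReal ((α + 1) * (1 - ‖z‖) ^ (-(α + 2))) * ∫⁻ t, ‖h t‖ₑ ∂μ := by
  refine (enorm_integral_le_lintegral_enorm _).trans ?_
  rw [← lintegral_const_mul' _ _ ENNReal.ofReal_ne_top]
  refine lintegral_mono fun t => ?_
  simp only
  rw [enorm_mul, mul_comm]
  refine mul_le_mul_left ?_ _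
  rw [← ofReal_norm]
  refine ENNReal.ofReal_le_ofReal ((norm_derivKernel_le hα hz t).trans
    (mul_le_mul_of_nonneg_left (Real.rpow_le_rpow_of_nonpos (by linarith) ?_ (by linarith))
      (by linarith)))
  nlinarith [t.2.1, t.2.2, norm_nonneg z]

theorem weighted_deriv_le_blochNorm (f : ℂ → ℂ) {z : ℂ} (hz : z ∈ unitDisk) :
    ENNReal.ofReal (1 - ‖z‖ ^ 2) * ‖deriv f z‖ₑ ≤ blochNorm f :=
  le_add_left (le_iSup₂ (f := fun z (_ : z ∈ unitDisk) =>
    ENNReal.ofReal (1 - ‖z‖ ^ 2) * ‖deriv f z‖ₑ) z hz)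

/-- Necessity of the vanishing Carleson condition. The modification `q` of the values of `f` only
has to fix the nonnegative reals, since the test functions are positive on `[0, 1)`. -/
theorem isVanishingCarleson_of_isCompactBergmanToBloch (hp : 0 < p) (hα : -1 < α)
    (hμ : ∫⁻ t : Ico (0 : ℝ) 1, ENNReal.ofReal ((1 - (t : ℝ)) ^ (-(2 / p))) ∂μ < ∞)
    {q : ℂ → ℂ} (hq : ∀ x : ℝ, 0 ≤ x → q x = x)
    (hT : IsCompactBergmanToBloch p fun f => kernelOp α μ fun t => q (f ((t : ℝ) : ℂ))) :
    IsVanishingCarleson (2 / p + α + 1) μ := by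
  by_contra hcon
  rw [IsVanishingCarleson, ENNReal.tendsto_nhds_zero] at hcon
  push Not at hcon
  obtain ⟨ε, hε, hfreq⟩ := hcon
  have hnear : ∀ᶠ t in 𝓝[<] (1 : ℝ), t ∈ Ioo (1 / 2 : ℝ) 1 :=
    Ioo_mem_nhdsLT (by norm_num)
  obtain ⟨r, hr, hrP⟩ := exists_seq_forall_of_frequently (hfreq.and_eventually hnear)
  set b : ℕ → Ico (0 : ℝ) 1 := fun n =>
    ⟨r n, by linarith [(hrP n).2.1], (hrP n).2.2⟩ with hb
  have hb1 : Tendsto (fun n => (b n : ℝ)) atTop (𝓝 1) := hr.mono_right nhdsWithin_le_nhds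
  have hop : ∀ n, (kernelOp α μ fun t => q (testFun p (b n) ((t : ℝ) : ℂ))) =
      kernelOp α μ fun t => (testVal p (b n) t : ℂ) := fun n => by
    congr 1
    funext t
    rw [testFun_coe, hq _ (testVal_nonneg _ _)]
  obtain ⟨φ, hφ, g, hg, hlim⟩ := hT.2 (fun n => testFun p (b n))
    (fun n => ⟨differentiableOn_testFun _,
      (bergmanNorm_testFun_le _ hp).trans_lt ENNReal.one_lt_top⟩)
    ⟨1, fun n => by simpa using bergmanNorm_testFun_le (b n) hp⟩
  simp only [hop] at hlim
  have hmeas : ∀ n, Measurable fun t => (testVal p (b n) t : ℂ) := fun n =>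
    Complex.measurable_ofReal.comp (measurable_testVal _)
  have hbound : ∀ n t, ‖(testVal p (b n) t : ℂ)‖ ≤
      2 ^ (2 / p) * (1 - (t : ℝ)) ^ (-(2 / p)) := fun n t => by
    rw [Complex.norm_real, Real.norm_of_nonneg (testVal_nonneg _ _)]
    exact testVal_le _ _ hp
  have hint : ∀ n, Integrable (fun t => (testVal p (b n) t : ℂ)) μ := fun n =>
    integrable_of_bound (by positivity) hμ (hmeas n) (hbound n)
  have hbφ : Tendsto (fun n => (b (φ n) : ℝ)) atTop (𝓝 1) := hb1.comp hφ.tendsto_atTop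
  have hL := tendsto_lintegral_enorm_zero hμ (fun n => hmeas (φ n)) (fun n => hbound (φ n))
    fun t => by
      have := (Complex.continuous_ofReal.tendsto 0).comp
        (tendsto_testVal_zero (p := p) t hp hbφ)
      rwa [Complex.ofReal_zero] at this
  have hsub : ∀ n, ∀ z ∈ unitDisk,
      deriv ((kernelOp α μ fun t => (testVal p (b n) t : ℂ)) - g) z =
        (∫ t, (testVal p (b n) t : ℂ) * derivKernel α z t ∂μ) - deriv g z := by
    intro n z hz
    have hgz : DifferentiableAt ℂ g z := hg.1.differentiableAt (Metric.isOpen_ball.mem_nhds hz)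
    exact ((hasDerivAt_kernelOp hα (hint n) (mem_unitDisk.1 hz)).sub hgz.hasDerivAt).deriv
  -- The test functions tend to zero on `[0, 1)`, so the limit in the Bloch space is constant.
  have hg0 : ∀ z ∈ unitDisk, deriv g z = 0 := by
    intro z hz
    have hz1 := mem_unitDisk.1 hz
    have hle : ∀ n, ENNReal.ofReal (1 - ‖z‖ ^ 2) * ‖deriv g z‖ₑ ≤
        blochNorm ((kernelOp α μ fun t => (testVal p (b (φ n)) t : ℂ)) - g) +
          ENNReal.ofReal (1 - ‖z‖ ^ 2) * (ENNReal.ofReal ((α + 1) * (1 - ‖z‖) ^ (-(α + 2))) *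
            ∫⁻ t, ‖(testVal p (b (φ n)) t : ℂ)‖ₑ ∂μ) := by
      intro n
      have h1 := weighted_deriv_le_blochNorm
        ((kernelOp α μ fun t => (testVal p (b (φ n)) t : ℂ)) - g) hz
      rw [hsub _ z hz] at h1
      have h2 := enorm_integral_derivKernel_le (μ := μ)
        (h := fun t => (testVal p (b (φ n)) t : ℂ)) hα hz1
      refine le_trans ?_ (add_le_add h1 (mul_le_mul_right h2 _))
      rw [← mul_add]
      refine mul_le_mul_right ?_ _
      set I := ∫ t, (testVal p (b (φ n)) t : ℂ) * derivKernel α z t ∂μ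
      calc ‖deriv g z‖ₑ = ‖-(I - deriv g z) + I‖ₑ := by congr 1; ring
        _ ≤ ‖I - deriv g z‖ₑ + ‖I‖ₑ := (enorm_add_le _ _).trans_eq (by rw [enorm_neg])
    have hzero := ge_of_tendsto' (hlim.add (ENNReal.Tendsto.const_mul
      (ENNReal.Tendsto.const_mul hL (Or.inr ENNReal.ofReal_ne_top))
      (Or.inr ENNReal.ofReal_ne_top))) hle
    rw [mul_zero, mul_zero, add_zero, nonpos_iff_eq_zero, mul_eq_zero] at hzero
    rcases hzero with h | h
    · exact absurd (ENNReal.ofReal_eq_zero.1 h) (by nlinarith [norm_nonneg z])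
    · exact enorm_eq_zero.1 h
  set c := ENNReal.ofReal ((α + 1) / 2 * 2 ^ (-(2 / p + α + 1))) with hc
  have hc0 : c ≠ 0 := (ENNReal.ofReal_pos.2 (mul_pos (by linarith) (by positivity))).ne'
  have hlow : ∀ n, c * ε ≤
      blochNorm ((kernelOp α μ fun t => (testVal p (b (φ n)) t : ℂ)) - g) := by
    intro n
    have hbz : ((b (φ n) : ℝ) : ℂ) ∈ unitDisk := by
      rw [mem_unitDisk, Complex.norm_real, Real.norm_of_nonneg (b (φ n)).2.1]
      exact (b (φ n)).2.2
    have h1 := weighted_deriv_le_blochNorm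
      ((kernelOp α μ fun t => (testVal p (b (φ n)) t : ℂ)) - g) hbz
    rw [hsub _ _ hbz, hg0 _ hbz, sub_zero] at h1
    refine le_trans ?_ ((mul_carlesonQuotient_le (b (φ n)) hp hα (hrP (φ n)).2.1.le
      (integrable_mul_derivKernel_and_hasDerivAt hα (hint _) (mem_unitDisk.1 hbz)).1).trans h1)
    exact mul_le_mul_right (hrP (φ n)).1.le _
  have hbad := ge_of_tendsto' hlim hlow
  rw [nonpos_iff_eq_zero, mul_eq_zero] at hbad
  exact hbad.elim hc0 hε.ne'

end BergmanBloch

theorem theorem4p10 (p α : ℝ) (hp : 0 < p) (hα : -1 < α) (μ : Measure (Set.Ico (0 : ℝ) 1))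
    (hμ : ∫⁻ t : Set.Ico (0 : ℝ) 1, ENNReal.ofReal (1 / (1 - (t : ℝ)) ^ (2 / p)) ∂μ < ∞) :
    List.TFAE [
      BergmanBloch.IsCompactBergmanToBloch p (BergmanBloch.hilbertOp α μ),
      BergmanBloch.IsCompactBergmanToBloch p (BergmanBloch.sublinearHilbertOp α μ),
      BergmanBloch.IsVanishingCarleson (2 / p + α + 1) μ] := by
  have hμ' : ∫⁻ t : Set.Ico (0 : ℝ) 1, ENNReal.ofReal ((1 - (t : ℝ)) ^ (-(2 / p))) ∂μ < ∞ := by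
    refine lt_of_eq_of_lt (lintegral_congr fun t => ?_) hμ
    rw [Real.rpow_neg (by linarith [t.2.2]), one_div]
  tfae_have 3 → 1 := fun h =>
    BergmanBloch.isCompactBergmanToBloch_of_isVanishingCarleson hp hα hμ' h
      (q := fun w => w) continuous_id fun _ => rfl
  tfae_have 3 → 2 := fun h =>
    BergmanBloch.isCompactBergmanToBloch_of_isVanishingCarleson hp hα hμ' h
      (q := fun w => ((‖w‖ : ℝ) : ℂ)) (by fun_prop) fun w => by simp
  tfae_have 1 → 3 := fun h =>
    BergmanBloch.isVanishingCarleson_of_isCompactBergmanToBloch hp hα hμ'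
      (q := fun w => w) (fun _ _ => rfl) h
  tfae_have 2 → 3 := fun h =>
    BergmanBloch.isVanishingCarleson_of_isCompactBergmanToBloch hp hα hμ'
      (q := fun w => ((‖w‖ : ℝ) : ℂ))
      (fun x hx => by rw [Complex.norm_real, Real.norm_of_nonneg hx]) h
  tfae_finish
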